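/- Let $\ell\ge 1$ and let $Q=\bigoplus_{i=1}^{\ell}\mathbb Z v_i$ be the lattice with $(v_i|v_j)=\delta_{ij}$, and let $\varepsilon:Q\times Q\to\{\pm1\}$ be the bimultiplicative function with $\varepsilon(v_i,v_j)=\epsilon_{ij}$, where $\epsilon_{ij}=1$ for $i<j$ and $\epsilon_{ij}=-1$ for $i\ge j$. Put $\mathfrak h=\mathbb C\otimes_{\mathbb Z}Q$, let $S$ be the symmetric algebra of $\bigoplus_{n>0}\mathfrak h s^{-n}$, and let $V_Q=S\otimes\mathbb C_\varepsilon[Q]$ be the state space of the lattice vertex algebra of $Q$, where $\mathbb C_\varepsilon[Q]$ has basis $\{e^\beta\}_{\beta\in Q}$; write $|0\rangle=1\otimes e^0$ and $e^\alpha=1\otimes e^\alpha$. For $h\in\mathfrak h$ let $h_{(-n)}$ with $n>0$ be the multiplication by $hs^{-n}$, let $h_{(0)}(g\otimes e^\beta)=(h|\beta)\,g\otimes e^\beta$, and let $h_{(n)}$ with $n>0$ be the derivation of $S$ with $h's^{-k}\mapsto n\,\delta_{n,k}(h|h')$. The state-field correspondence $Y(a,z)=\sum_{m\in\mathbb Z}a_{(m)}z^{-m-1}$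 is determined by $Y(hs^{-1}\otimes e^0,z)=h(z)=\sum_m h_{(m)}z^{-m-1}$, by $$Y(e^\alpha,z)=E^\alpha(z)=e^{\alpha}z^{\alpha_{(0)}}\exp\Big(\sum_{n>0}\alpha_{(-n)}\frac{z^n}{n}\Big)\exp\Big(\sum_{n<0}\alpha_{(-n)}\frac{z^n}{n}\Big),\qquad e^\alpha(g\otimes e^\beta)=\varepsilon(\alpha,\beta)\,g\otimes e^{\alpha+\beta},$$ and in general by $$Y\big(h_1s^{-m_1-1}\cdots h_ks^{-m_k-1}\otimes e^\alpha,z\big)=\frac{1}{m_1!\cdots m_k!}:\partial_z^{m_1}h_1(z)\cdots\partial_z^{m_k}h_k(z)\,E^\alpha(z):,$$ where the normally ordered product is expanded from the right to the left by $:A(z)B(z):\;=A(z)_{\ge0}B(z)+B(z)A(z)_{<0}$, with $A(z)_{\ge 0}$ and $A(z)_{<0}$ the parts of $A(z)$ with nonnegative and with negative powers of $z$. Let $e_{kl}=\epsilon_{lk}e^{v_k-v_l}$ for $k\ne l$, let $\mathring{\mathfrak g}\subset V_Q$ be the span of the $v_i-v_{i+1}$ (that is, $(v_i-v_{i+1})s^{-1}\otimes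 e^0$), $1\le i\le \ell-1$, and the $e_{kl}$, and let $$\mathfrak g=\mathrm{span}\{a_{(m)} \mid a\in\mathring{\mathfrak g},\ m\in\mathbb Z\}+\mathbb C\,\mathrm{Id}_{V_Q}\subset \mathrm{End}(V_Q)$$ (a realization of the affine Lie algebra of $\mathfrak{sl}_\ell$). On $V_Q\boxtimes V_Q$ let $\mathbb Y(a\boxtimes b,z)=Y(a,z)\boxtimes Y(b,z)$, extended bilinearly, let $\Omega=\sum_{k=1}^{\ell}e^{v_k}\boxtimes e^{-v_k}$, and write $\mathbb Y(\Omega,z)=\sum_{m\in\mathbb Z}\Omega_{(m)}z^{-m-1}$. Theorem. Let $X\in\mathfrak g$ be such that $Z=e^{X}|0\rangle\in V_Q$, i.e. $Z\in V_Q$ and the series $\sum_{n\ge0}\frac{1}{n!}X^n|0\rangle$ converges to $Z$ coefficient by coefficient with respect to the basis of $V_Q$ formed by the $v_{i_1}s^{-n_1}\cdots v_{i_k}s^{-n_k}\otimes e^\beta$. Then $$\Omega_{(m)}(Z\boxtimes Z)=0\qquad\text{for all } m\ge 0 .$$ -/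

import Mathlib

namespace LatticeVA

/-! ### Fields on a complex vector space -/

section Fields

variable {M N : Type*} [AddCommGroup M] [Module ℂ M] [AddCommGroup N] [Module ℂ N]

/-- The sum of a locally finite family of linear maps: on each vector only finitely many of the
maps are nonzero. -/
noncomputable def lfSum {ι : Type*} (T : ι → M →ₗ[ℂ] N)
    (hT : ∀ u, (Function.support fun i => T i u).Finite) : M →ₗ[ℂ] N where
  toFun u := ∑ᶠ i, T i u
  map_add' u v := by
    simp only [map_add]
    exact finsum_add_distrib (hT u) (hT v)
  map_smul' c u := by
    simp only [map_smul, RingHom.id_apply]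
    exact (smul_finsum' c (hT u)).symm

theorem lfSum_eq_zero {ι : Type*} (T : ι → M →ₗ[ℂ] N)
    (hT : ∀ u, (Function.support fun i => T i u).Finite) (u : M) (h : ∀ i, T i u = 0) :
    lfSum T hT u = 0 := by
  change ∑ᶠ i, T i u = 0
  simp [h]

variable (M) in
/-- Fields on `M`. A family `A` of endomorphisms stands for the formal series
`A(z) = ∑ n, A n * z ^ (-n - 1)`, so `A n` is the `n`-th mode `A_(n)`. The series is a field if
each vector is killed by `A n` for all large `n`. -/
def FieldSpace : Submodule ℂ (ℤ → Module.End ℂ M) where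
  carrier := {A | ∀ u, ∃ K : ℤ, ∀ n, K ≤ n → A n u = 0}
  zero_mem' := fun u => ⟨0, fun n _ => rfl⟩
  add_mem' := by
    intro A B hA hB u
    obtain ⟨K, hK⟩ := hA u
    obtain ⟨L, hL⟩ := hB u
    refine ⟨max K L, fun n hn => ?_⟩
    simp [hK n (le_trans (le_max_left _ _) hn), hL n (le_trans (le_max_right _ _) hn)]
  smul_mem' := by
    intro c A hA u
    obtain ⟨K, hK⟩ := hA u
    exact ⟨K, fun n hn => by simp [hK n hn]⟩

/-- The derivative of a field: the coefficient of `z ^ (-n - 1)` in `∂A(z)` is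
`-n * A (n - 1)`. -/
noncomputable def fieldDeriv (A : FieldSpace M) : FieldSpace M :=
  ⟨fun n => (-(n : ℂ)) • A.1 (n - 1), by
    intro u
    obtain ⟨K, hK⟩ := A.2 u
    exact ⟨K + 1, fun n hn => by simp [hK (n - 1) (by omega)]⟩⟩

/-- The `j`-th summand of the `n`-th mode of the normally ordered product `:A(z)B(z):`. The modes
`A j` with `j < 0` are the coefficients in `A(z)` of the powers `z ^ k` with `k ≥ 0`; they stand
on the left of `B(z)`, the others on the right. -/
noncomputable def normalOrderTerm (A B : FieldSpace M) (n j : ℤ) : Module.End ℂ M :=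
  if j < 0 then A.1 j * B.1 (n - 1 - j) else B.1 (n - 1 - j) * A.1 j

theorem normalOrderTerm_finite (A B : FieldSpace M) (n : ℤ) (u : M) :
    (Function.support fun j => normalOrderTerm A B n j u).Finite := by
  obtain ⟨K, hK⟩ := A.2 u
  obtain ⟨L, hL⟩ := B.2 u
  refine (Set.finite_Icc (min 0 (n - 1 - L)) (max 0 K)).subset fun j hj => ?_
  by_contra hcon
  apply hj
  simp only [Set.mem_Icc, not_and_or, not_le] at hcon
  change normalOrderTerm A B n j u = 0
  unfold normalOrderTerm
  split_ifs with h0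
  · simp [hL (n - 1 - j) (by omega)]
  · simp [hK j (by omega)]

/-- The normally ordered product `:A(z)B(z): = A(z)_{≥0} B(z) + B(z) A(z)_{<0}`. -/
noncomputable def normalOrder (A B : FieldSpace M) : FieldSpace M :=
  ⟨fun n => lfSum (normalOrderTerm A B n) (normalOrderTerm_finite A B n), by
    intro u
    obtain ⟨K, hK⟩ := A.2 u
    obtain ⟨L, hL⟩ := B.2 u
    choose P hP using fun j : ℤ => B.2 (A.1 j u)
    obtain ⟨R, hR⟩ := ((Finset.Ico 0 K).image fun j => P j + 1 + j).bddAbove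
    refine ⟨max L R, fun n hn => lfSum_eq_zero _ _ _ fun j => ?_⟩
    unfold normalOrderTerm
    split_ifs with h0
    · simp [hL (n - 1 - j) (by omega)]
    · by_cases hj : j < K
      · have h1 : P j + 1 + j ≤ R :=
          hR (Finset.mem_coe.2 (Finset.mem_image_of_mem _ (Finset.mem_Ico.2 ⟨by omega, hj⟩)))
        simp [hP j (n - 1 - j) (by omega)]
      · simp [hK j (by omega)]⟩

open scoped TensorProduct

theorem boxTerm_eq_zero (A : FieldSpace M) (B : FieldSpace N) (u : M ⊗[ℂ] N) :
    ∃ K L : ℤ, ∀ p q, K ≤ p ∨ L ≤ q → TensorProduct.map (A.1 p) (B.1 q) u = 0 := by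
  induction u using TensorProduct.induction_on with
  | zero => exact ⟨0, 0, fun p q _ => by simp⟩
  | tmul x y =>
    obtain ⟨K, hK⟩ := A.2 x
    obtain ⟨L, hL⟩ := B.2 y
    refine ⟨K, L, fun p q h => ?_⟩
    rcases h with h | h
    · simp [hK p h]
    · simp [hL q h]
  | add x y hx hy =>
    obtain ⟨K, L, h⟩ := hx
    obtain ⟨K', L', h'⟩ := hy
    refine ⟨max K K', max L L', fun p q hpq => ?_⟩
    rw [map_add, h p q (by omega), h' p q (by omega), add_zero]

theorem boxTerm_finite (A : FieldSpace M) (B : FieldSpace N) (n : ℤ) (u : M ⊗[ℂ] N) :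
    (Function.support fun p : ℤ => TensorProduct.map (A.1 p) (B.1 (n - 1 - p)) u).Finite := by
  obtain ⟨K, L, h⟩ := boxTerm_eq_zero A B u
  refine (Set.finite_Icc (n - 1 - L) K).subset fun p hp => ?_
  by_contra hcon
  apply hp
  simp only [Set.mem_Icc, not_and_or, not_le] at hcon
  exact h _ _ (by omega)

/-- The field `A(z) ⊠ B(z)` on `M ⊗ N`. Its `n`-th mode, the coefficient of `z ^ (-n - 1)`, is the
sum of all `A p ⊗ B q` with `p + q = n - 1`. -/
noncomputable def boxField (A : FieldSpace M) (B : FieldSpace N) : FieldSpace (M ⊗[ℂ] N) :=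
  ⟨fun n => lfSum (fun p : ℤ => TensorProduct.map (A.1 p) (B.1 (n - 1 - p)))
      (boxTerm_finite A B n), by
    intro u
    obtain ⟨K, L, h⟩ := boxTerm_eq_zero A B u
    exact ⟨K + L, fun n hn => lfSum_eq_zero _ _ _ fun p => h _ _ (by omega)⟩⟩

theorem boxField_apply (A : FieldSpace M) (B : FieldSpace N) (n : ℤ) (u : M ⊗[ℂ] N) :
    (boxField A B).1 n u = ∑ᶠ p : ℤ, TensorProduct.map (A.1 p) (B.1 (n - 1 - p)) u := rfl

variable (M N) in
/-- `(A, B) ↦ A(z) ⊠ B(z)` as a bilinear map. -/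
noncomputable def boxFieldBilin :
    FieldSpace M →ₗ[ℂ] FieldSpace N →ₗ[ℂ] FieldSpace (M ⊗[ℂ] N) :=
  LinearMap.mk₂ ℂ boxField
    (fun A A' B => by
      refine Subtype.ext (funext fun n => LinearMap.ext fun u => ?_)
      change (boxField (A + A') B).1 n u = (boxField A B).1 n u + (boxField A' B).1 n u
      simp only [boxField_apply]
      rw [← finsum_add_distrib (boxTerm_finite A B n u) (boxTerm_finite A' B n u)]
      exact finsum_congr fun p => by simp [TensorProduct.map_add_left])
    (fun c A B => by
      refine Subtype.ext (funext fun n => LinearMap.ext fun u => ?_)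
      change (boxField (c • A) B).1 n u = c • (boxField A B).1 n u
      simp only [boxField_apply]
      rw [smul_finsum' c (boxTerm_finite A B n u)]
      exact finsum_congr fun p => by simp [TensorProduct.map_smul_left])
    (fun A B B' => by
      refine Subtype.ext (funext fun n => LinearMap.ext fun u => ?_)
      change (boxField A (B + B')).1 n u = (boxField A B).1 n u + (boxField A B').1 n u
      simp only [boxField_apply]
      rw [← finsum_add_distrib (boxTerm_finite A B n u) (boxTerm_finite A B' n u)]
      exact finsum_congr fun p => by simp [TensorProduct.map_add_right])
    (fun c A B => by
      refine Subtype.ext (funext fun n => LinearMap.ext fun u => ?_)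
      change (boxField A (c • B)).1 n u = c • (boxField A B).1 n u
      simp only [boxField_apply]
      rw [smul_finsum' c (boxTerm_finite A B n u)]
      exact finsum_congr fun p => by simp [TensorProduct.map_smul_right])

end Fields

/-- The coefficient of `z ^ k` in `exp A(z) = ∑ n, A(z) ^ n / n!`, for a power series `A(z)` with
zero constant term (so that only the powers with `n ≤ k` contribute). -/
noncomputable def expCoeff {R : Type*} [Ring R] [Algebra ℂ R] (A : PowerSeries R) (k : ℕ) : R :=
  ∑ n ∈ Finset.range (k + 1), ((n.factorial : ℂ)⁻¹) • PowerSeries.coeff k (A ^ n)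

/-! ### The lattice `Q = ⊕ ℤ v_i`, its form and its cocycle -/

/-- The lattice `Q = ⊕ ℤ v_i`; an element is given by its coordinates. -/
abbrev Lat (ℓ : ℕ) : Type := Fin ℓ → ℤ

/-- The complexification `𝔥 = ℂ ⊗ Q`; an element is given by its coordinates. -/
abbrev Car (ℓ : ℕ) : Type := Fin ℓ → ℂ

/-- The basis vector `v_i` of `Q`. -/
def latV {ℓ : ℕ} (i : Fin ℓ) : Lat ℓ := Pi.single i 1

/-- The bilinear form on `Q` with `(v_i | v_j) = δ_{ij}`. -/
def latForm {ℓ : ℕ} (α β : Lat ℓ) : ℤ := ∑ i, α i * β i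

/-- The inclusion of `Q` into `𝔥`. -/
def latToCar {ℓ : ℕ} (α : Lat ℓ) : Car ℓ := fun i => (α i : ℂ)

/-- `ε_{ij}`, equal to `1` for `i < j` and to `-1` for `i ≥ j`. -/
def epsSign {ℓ : ℕ} (i j : Fin ℓ) : ℤˣ := if i < j then 1 else -1

/-- The bimultiplicative function `ε : Q × Q → {±1}` with `ε(v_i, v_j) = ε_{ij}`. -/
def eps {ℓ : ℕ} (α β : Lat ℓ) : ℤˣ := ∏ i, ∏ j, epsSign i j ^ (α i * β j)

/-! ### The state space and the basic operators -/

/-- The symmetric algebra `S` over `𝔥^{<0}`, as the polynomial algebra in the basis vectors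
`v_i s^{-m}`, `m ≥ 1`. The variable with index `(i, k)` is `v_i s^{-(k+1)}`. -/
abbrev SymNeg (ℓ : ℕ) : Type := MvPolynomial (Fin ℓ × ℕ) ℂ

/-- The space of states `V_Q = S ⊗ ℂ_ε[Q]`; the vector `g ⊗ e^β` is `Finsupp.single β g`. -/
abbrev VQ (ℓ : ℕ) : Type := Lat ℓ →₀ SymNeg ℓ

/-- The vacuum vector `|0⟩ = 1 ⊗ e^0`. -/
noncomputable def vac (ℓ : ℕ) : VQ ℓ := Finsupp.single 0 1

/-- The vector `e^α = 1 ⊗ e^α`. -/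
noncomputable def expVec {ℓ : ℕ} (α : Lat ℓ) : VQ ℓ := Finsupp.single α 1

/-- The vector `h = h s^{-1} ⊗ e^0`, for `h ∈ 𝔥`. -/
noncomputable def carVec {ℓ : ℕ} (h : Car ℓ) : VQ ℓ :=
  Finsupp.single 0 (∑ i, h i • MvPolynomial.X (i, 0))

/-- The operator `h_(m)` on `V_Q`, for `h ∈ 𝔥` and `m ∈ ℤ`: on `g ⊗ e^β` it is the multiplication
of `g` by `h s^m` if `m < 0`, the scalar `(h | β)` if `m = 0`, and the derivation of `S` with
`g' s^{-n} ↦ δ_{m,n} n (h | g')` if `m > 0`. -/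
noncomputable def heis {ℓ : ℕ} (h : Car ℓ) : ℤ → Module.End ℂ (VQ ℓ)
  | Int.ofNat 0 => Finsupp.lsum ℂ fun β => (∑ i, h i * (β i : ℂ)) • Finsupp.lsingle β
  | Int.ofNat (k + 1) => Finsupp.mapRange.linearMap
      (((k + 1 : ℕ) : ℂ) • ∑ i, h i • (MvPolynomial.pderiv (R := ℂ) (i, k)).toLinearMap)
  | Int.negSucc k => Finsupp.mapRange.linearMap
      (LinearMap.mulLeft ℂ (∑ i, h i • (MvPolynomial.X (i, k) : SymNeg ℓ)))

/-- The operator `e^α` on `V_Q`: `e^α (g ⊗ e^β) = ε(α, β) g ⊗ e^{α + β}`. -/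
noncomputable def shiftOp {ℓ : ℕ} (α : Lat ℓ) : Module.End ℂ (VQ ℓ) :=
  Finsupp.lsum ℂ fun β => (((eps α β : ℤˣ) : ℤ) : ℂ) • Finsupp.lsingle (α + β)

/-- The coefficient of `z ^ c` in `z ^ {α_(0)}`: the projection of `V_Q` onto the span of the
`g ⊗ e^β` with `(α | β) = c`. -/
noncomputable def zeroModeProj {ℓ : ℕ} (α : Lat ℓ) (c : ℤ) : Module.End ℂ (VQ ℓ) :=
  Finsupp.lsum ℂ fun β => if latForm α β = c then Finsupp.lsingle β else 0

/-- The coefficient of `z ^ k` in `exp (∑_{n > 0} α_(-n) z ^ n / n)`. -/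
noncomputable def expPos {ℓ : ℕ} (α : Lat ℓ) (k : ℕ) : Module.End ℂ (VQ ℓ) :=
  expCoeff (PowerSeries.mk fun n : ℕ =>
    if n = 0 then 0 else ((n : ℂ)⁻¹) • heis (latToCar α) (-(n : ℤ))) k

/-- The coefficient of `z ^ (-k)` in
`exp (∑_{n < 0} α_(-n) z ^ n / n) = exp (-∑_{n > 0} α_(n) z ^ (-n) / n)`. -/
noncomputable def expNeg {ℓ : ℕ} (α : Lat ℓ) (k : ℕ) : Module.End ℂ (VQ ℓ) :=
  expCoeff (PowerSeries.mk fun n : ℕ =>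
    if n = 0 then 0 else (-(n : ℂ)⁻¹) • heis (latToCar α) (n : ℤ)) k

/-! ### Local nilpotency of the positive modes -/

/-- The degree of a monomial, where `v_i s^{-m}` has degree `m`. -/
def wt {ℓ : ℕ} (s : Fin ℓ × ℕ →₀ ℕ) : ℤ := s.sum fun p c => (c : ℤ) * ((p.2 : ℤ) + 1)

/-- The span of the `g ⊗ e^β` with `g` a monomial of degree at most `d`. -/
noncomputable def filt (ℓ : ℕ) (d : ℤ) : Submodule ℂ (VQ ℓ) :=
  Submodule.span ℂ {u | ∃ β s, wt s ≤ d ∧ u = Finsupp.single β (MvPolynomial.monomial s 1)}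

theorem wt_nonneg {ℓ : ℕ} (s : Fin ℓ × ℕ →₀ ℕ) : 0 ≤ wt s :=
  Finset.sum_nonneg fun p _ => by positivity

theorem wt_add {ℓ : ℕ} (s t : Fin ℓ × ℕ →₀ ℕ) : wt (s + t) = wt s + wt t := by
  unfold wt
  rw [Finsupp.sum_add_index']
  · simp
  · intro p a b
    push_cast
    ring

theorem filt_mono {ℓ : ℕ} {d e : ℤ} (h : d ≤ e) : filt ℓ d ≤ filt ℓ e := by
  apply Submodule.span_mono
  rintro u ⟨β, s, hs, rfl⟩
  exact ⟨β, s, hs.trans h, rfl⟩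

theorem filt_neg {ℓ : ℕ} {d : ℤ} (h : d < 0) {u : VQ ℓ} (hu : u ∈ filt ℓ d) : u = 0 := by
  have : {u : VQ ℓ | ∃ β s, wt s ≤ d ∧ u = Finsupp.single β (MvPolynomial.monomial s 1)} = ∅ := by
    ext u
    simp only [Set.mem_ofPred_eq, Set.mem_empty_iff_false, iff_false]
    rintro ⟨β, s, hs, -⟩
    have := wt_nonneg s
    omega
  simpa [filt, this] using hu

theorem exists_mem_filt {ℓ : ℕ} (u : VQ ℓ) : ∃ d : ℕ, u ∈ filt ℓ d := by
  induction u using Finsupp.induction_linear with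
  | zero => exact ⟨0, Submodule.zero_mem _⟩
  | add u v hu hv =>
    obtain ⟨d, hd⟩ := hu
    obtain ⟨e, he⟩ := hv
    exact ⟨max d e, Submodule.add_mem _ (filt_mono (by simp) hd) (filt_mono (by simp) he)⟩
  | single β g =>
    induction g using MvPolynomial.induction_on' with
    | monomial s c =>
      refine ⟨(wt s).toNat, ?_⟩
      have : (Finsupp.single β (MvPolynomial.monomial s c) : VQ ℓ) =
          c • Finsupp.single β (MvPolynomial.monomial s 1) := by
        rw [Finsupp.smul_single, MvPolynomial.smul_monomial]
        simp
      rw [this]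
      exact Submodule.smul_mem _ _ (Submodule.subset_span ⟨β, s, by simp, rfl⟩)
    | add p q hp hq =>
      obtain ⟨d, hd⟩ := hp
      obtain ⟨e, he⟩ := hq
      rw [Finsupp.single_add]
      exact ⟨max d e, Submodule.add_mem _ (filt_mono (by simp) hd) (filt_mono (by simp) he)⟩

theorem heis_mem_filt {ℓ : ℕ} (h : Car ℓ) {n : ℕ} (hn : n ≠ 0) {d : ℤ} {u : VQ ℓ}
    (hu : u ∈ filt ℓ d) : heis h (n : ℤ) u ∈ filt ℓ (d - n) := by
  obtain ⟨k, rfl⟩ := Nat.exists_eq_succ_of_ne_zero hn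
  refine Submodule.span_induction (p := fun u _ => heis h ((k + 1 : ℕ) : ℤ) u ∈ filt ℓ _)
    ?_ ?_ ?_ ?_ hu
  · rintro _ ⟨β, s, hs, rfl⟩
    change Finsupp.mapRange.linearMap _ _ ∈ _
    rw [Finsupp.mapRange.linearMap_apply, Finsupp.mapRange_single]
    have key : ∀ i, (Finsupp.single β (MvPolynomial.pderiv (R := ℂ) (i, k)
        (MvPolynomial.monomial s 1)) : VQ ℓ) ∈ filt ℓ (d - ((k + 1 : ℕ) : ℤ)) := by
      intro i
      rw [MvPolynomial.pderiv_monomial]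
      by_cases hs0 : s (i, k) = 0
      · simp [hs0]
      · have e1 : (Finsupp.single β (MvPolynomial.monomial (s - Finsupp.single (i, k) 1)
            ((1 : ℂ) * (s (i, k) : ℂ))) : VQ ℓ) = (s (i, k) : ℂ) •
            Finsupp.single β (MvPolynomial.monomial (s - Finsupp.single (i, k) 1) 1) := by
          rw [Finsupp.smul_single, MvPolynomial.smul_monomial]
          simp
        rw [e1]
        refine Submodule.smul_mem _ _ (Submodule.subset_span ⟨β, _, ?_, rfl⟩)
        have e2 : s - Finsupp.single (i, k) 1 + Finsupp.single (i, k) 1 = s :=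
          tsub_add_cancel_of_le (by
            rw [Finsupp.single_le_iff]
            omega)
        have e3 : wt (Finsupp.single (i, k) 1 : Fin ℓ × ℕ →₀ ℕ) = (k : ℤ) + 1 := by
          simp [wt]
        have e4 := wt_add (s - Finsupp.single (i, k) 1) (Finsupp.single (i, k) 1)
        rw [e2, e3] at e4
        push_cast
        omega
    have e5 : (Finsupp.single β ((((k + 1 : ℕ) : ℂ) •
        ∑ i, h i • (MvPolynomial.pderiv (R := ℂ) (i, k)).toLinearMap)
        (MvPolynomial.monomial s 1)) : VQ ℓ) = ((k + 1 : ℕ) : ℂ) • ∑ i, h i •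
        Finsupp.single β (MvPolynomial.pderiv (R := ℂ) (i, k) (MvPolynomial.monomial s 1)) := by
      simp only [LinearMap.smul_apply, LinearMap.sum_apply, Finsupp.smul_single,
        ← Finsupp.single_finsetSum]
      rfl
    rw [e5]
    exact Submodule.smul_mem _ _ (Submodule.sum_mem _ fun i _ => Submodule.smul_mem _ _ (key i))
  · simp
  · intro x y _ _ hx hy
    rw [map_add]
    exact Submodule.add_mem _ hx hy
  · intro c x _ hx
    rw [map_smul]
    exact Submodule.smul_mem _ _ hx

theorem expNeg_mem_filt {ℓ : ℕ} (α : Lat ℓ) (k : ℕ) {d : ℤ} {u : VQ ℓ} (hu : u ∈ filt ℓ d) :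
    expNeg α k u ∈ filt ℓ (d - k) := by
  have key : ∀ n k : ℕ, ∀ d : ℤ, ∀ u ∈ filt ℓ d, PowerSeries.coeff k ((PowerSeries.mk
      fun n : ℕ => if n = 0 then (0 : Module.End ℂ (VQ ℓ)) else
        (-(n : ℂ)⁻¹) • heis (latToCar α) (n : ℤ)) ^ n) u ∈ filt ℓ (d - k) := by
    intro n
    induction n with
    | zero =>
      intro k d u hu
      rw [pow_zero, PowerSeries.coeff_one]
      split_ifs with h
      · subst h
        simpa using hu
      · simp
    | succ n ih =>
      intro k d u hu
      rw [pow_succ, PowerSeries.coeff_mul, LinearMap.sum_apply]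
      refine Submodule.sum_mem _ fun p hp => ?_
      rw [Finset.HasAntidiagonal.mem_antidiagonal] at hp
      rw [Module.End.mul_apply, PowerSeries.coeff_mk]
      have e : d - (k : ℤ) = d - p.2 - p.1 := by omega
      rw [e]
      apply ih
      split_ifs with h
      · simp
      · exact Submodule.smul_mem _ _ (heis_mem_filt _ h hu)
  unfold expNeg expCoeff
  rw [LinearMap.sum_apply]
  exact Submodule.sum_mem _ fun n _ => Submodule.smul_mem _ _ (key n k d u hu)

theorem expNeg_eq_zero {ℓ : ℕ} (α : Lat ℓ) (u : VQ ℓ) :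
    ∃ K : ℕ, ∀ k, K ≤ k → expNeg α k u = 0 := by
  obtain ⟨d, hd⟩ := exists_mem_filt u
  exact ⟨d + 1, fun k hk => filt_neg (by omega) (expNeg_mem_filt α k hd)⟩

theorem zeroModeProj_eq_zero {ℓ : ℕ} (α : Lat ℓ) (u : VQ ℓ) :
    ∃ C : ℤ, ∀ c, c < -C ∨ C < c → zeroModeProj α c u = 0 := by
  obtain ⟨C, hC⟩ := (u.support.image fun β => |latForm α β|).bddAbove
  refine ⟨C, fun c hc => ?_⟩
  unfold zeroModeProj
  rw [Finsupp.lsum_apply]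
  refine Finset.sum_eq_zero fun β hβ => ?_
  have h1 : |latForm α β| ≤ C := hC (Finset.mem_coe.2 (Finset.mem_image_of_mem _ hβ))
  rw [abs_le] at h1
  change (if latForm α β = c then Finsupp.lsingle β else 0 : SymNeg ℓ →ₗ[ℂ] VQ ℓ) (u β) = 0
  rw [if_neg (by omega)]
  rfl

theorem expNeg_zeroModeProj {ℓ : ℕ} (α : Lat ℓ) (u : VQ ℓ) :
    ∃ C K : ℤ, ∀ (c : ℤ) (k : ℕ), c < -C ∨ C < c ∨ K ≤ k →
      expNeg α k (zeroModeProj α c u) = 0 := by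
  obtain ⟨C, hC⟩ := zeroModeProj_eq_zero α u
  choose K hK using fun c : ℤ => expNeg_eq_zero α (zeroModeProj α c u)
  obtain ⟨R, hR⟩ := ((Finset.Icc (-C) C).image K).bddAbove
  refine ⟨C, R, fun c k h => ?_⟩
  by_cases hc : c < -C ∨ C < c
  · rw [hC c hc, map_zero]
  · have h1 : K c ≤ R :=
      hR (Finset.mem_coe.2 (Finset.mem_image_of_mem _ (Finset.mem_Icc.2 (by omega))))
    exact hK c k (by omega)

/-! ### The state-field correspondence -/

/-- The field `h(z) = ∑ h_(m) z ^ (-m - 1)`. -/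
noncomputable def heisField {ℓ : ℕ} (h : Car ℓ) : FieldSpace (VQ ℓ) :=
  ⟨heis h, by
    intro u
    obtain ⟨d, hd⟩ := exists_mem_filt u
    refine ⟨d + 1, fun n hn => ?_⟩
    obtain ⟨m, rfl⟩ := Int.eq_ofNat_of_zero_le (show 0 ≤ n by omega)
    exact filt_neg (by omega) (heis_mem_filt h (by omega) hd)⟩

/-- The contribution to the `m`-th mode of `E^α(z)` of the `z ^ j` of the first exponential and the
`z ^ (-k)` of the second one; `z ^ {α_(0)}`, which commutes with both exponentials, then has to
contribute `z ^ (-m - 1 - j + k)`. -/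
noncomputable def expTerm {ℓ : ℕ} (α : Lat ℓ) (m : ℤ) (p : ℕ × ℕ) : Module.End ℂ (VQ ℓ) :=
  shiftOp α * expPos α p.1 * expNeg α p.2 * zeroModeProj α (-m - 1 - p.1 + p.2)

theorem expTerm_finite {ℓ : ℕ} (α : Lat ℓ) (m : ℤ) (u : VQ ℓ) :
    (Function.support fun p => expTerm α m p u).Finite := by
  obtain ⟨C, K, h⟩ := expNeg_zeroModeProj α u
  refine ((Set.finite_Iio (C - m + K).toNat).prod (Set.finite_Iio K.toNat)).subset
    fun p hp => ?_
  by_contra hcon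
  apply hp
  simp only [Set.mem_prod, Set.mem_Iio, not_and_or, not_lt] at hcon
  change shiftOp α (expPos α p.1 (expNeg α p.2 (zeroModeProj α (-m - 1 - p.1 + p.2) u))) = 0
  rw [h _ _ (by omega), map_zero, map_zero]

/-- The field
`E^α(z) = e^α z^{α_(0)} exp(∑_{n > 0} α_(-n) z ^ n / n) exp(∑_{n < 0} α_(-n) z ^ n / n)`. -/
noncomputable def expField {ℓ : ℕ} (α : Lat ℓ) : FieldSpace (VQ ℓ) :=
  ⟨fun m => lfSum (expTerm α m) (expTerm_finite α m), by
    intro u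
    obtain ⟨C, K, h⟩ := expNeg_zeroModeProj α u
    refine ⟨C + K, fun m hm => lfSum_eq_zero _ _ _ fun p => ?_⟩
    change shiftOp α (expPos α p.1 (expNeg α p.2 (zeroModeProj α (-m - 1 - p.1 + p.2) u))) = 0
    rw [h _ _ (by omega), map_zero, map_zero]⟩

/-- The state-field correspondence `a ↦ Y(a, z)` of the lattice vertex algebra `V_Q`. On
`h_1 s^{-m_1-1} ⋯ h_k s^{-m_k-1} ⊗ e^α`, with all `h_i` in the basis `v_1, …, v_ℓ`, it is
`:(∂^{m_1} h_1(z) / m_1!) ⋯ (∂^{m_k} h_k(z) / m_k!) E^α(z):`, the normally ordered product being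
expanded from the right to the left. It does not depend on the order of the factors. -/
noncomputable def stateField (ℓ : ℕ) : VQ ℓ →ₗ[ℂ] FieldSpace (VQ ℓ) :=
  Finsupp.lsum ℂ fun α => (MvPolynomial.basisMonomials (Fin ℓ × ℕ) ℂ).constr ℂ fun s =>
    (Finsupp.toMultiset s).toList.foldr
      (fun p A => normalOrder
        (((p.2.factorial : ℂ)⁻¹) • fieldDeriv^[p.2] (heisField (latToCar (latV p.1)))) A)
      (expField α)

/-- The mode `a_(m)` in `Y(a, z) = ∑ a_(m) z ^ (-m - 1)`. -/
noncomputable def mode {ℓ : ℕ} (a : VQ ℓ) (m : ℤ) : Module.End ℂ (VQ ℓ) := (stateField ℓ a).1 m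

/-! ### The affine Lie algebra inside `End V_Q` -/

/-- `e_{kl} = ε_{lk} e^{v_k - v_l}`. -/
noncomputable def eVec {ℓ : ℕ} (k l : Fin ℓ) : VQ ℓ :=
  (((epsSign l k : ℤˣ) : ℤ) : ℂ) • expVec (latV k - latV l)

/-- The copy of `sl_ℓ` in `V_Q`, spanned by the `v_i - v_{i+1}` and the `e_{kl}`, `k ≠ l`. -/
noncomputable def slSpace (ℓ : ℕ) : Submodule ℂ (VQ ℓ) :=
  Submodule.span ℂ
    ({a | ∃ i j : Fin ℓ, (i : ℕ) + 1 = j ∧ a = carVec (latToCar (latV i - latV j))} ∪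
      {a | ∃ k l : Fin ℓ, k ≠ l ∧ a = eVec k l})

/-- The realization of the affine Lie algebra of `sl_ℓ` by operators on `V_Q`: the span of the modes
`a_(m)`, with `a` in the copy of `sl_ℓ` and `m ∈ ℤ`, and of the identity. -/
noncomputable def affineSpace (ℓ : ℕ) : Submodule ℂ (Module.End ℂ (VQ ℓ)) :=
  Submodule.span ℂ {X | ∃ a ∈ slSpace ℓ, ∃ m : ℤ, X = mode a m} ⊔ Submodule.span ℂ {1}

/-- `Z = e^X u` in `V_Q`: the series `∑ X^n u / n!` converges to `Z`, coefficient by coefficient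
with respect to the basis of the `g ⊗ e^β`, `g` a monomial in the `v_i s^{-m}`. -/
def IsExpApply {ℓ : ℕ} (X : Module.End ℂ (VQ ℓ)) (u Z : VQ ℓ) : Prop :=
  ∀ (β : Lat ℓ) (s : Fin ℓ × ℕ →₀ ℕ),
    Filter.Tendsto
      (fun N : ℕ => ∑ n ∈ Finset.range N,
        ((n.factorial : ℂ)⁻¹) * MvPolynomial.coeff s ((X ^ n) u β))
      Filter.atTop (nhds (MvPolynomial.coeff s (Z β)))

/-! ### The tensor square -/

open scoped TensorProduct

/-- The state-field correspondence on `V_Q ⊠ V_Q`, with `a ⊠ b ↦ Y(a, z) ⊠ Y(b, z)`. -/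
noncomputable def stateField₂ (ℓ : ℕ) : VQ ℓ ⊗[ℂ] VQ ℓ →ₗ[ℂ] FieldSpace (VQ ℓ ⊗[ℂ] VQ ℓ) :=
  TensorProduct.lift ((boxFieldBilin (VQ ℓ) (VQ ℓ)).compl₁₂ (stateField ℓ) (stateField ℓ))

/-- `Ω = ∑_k e^{v_k} ⊠ e^{-v_k}`. -/
noncomputable def Om (ℓ : ℕ) : VQ ℓ ⊗[ℂ] VQ ℓ :=
  ∑ k : Fin ℓ, expVec (latV k) ⊗ₜ[ℂ] expVec (-latV k)

/-- The mode `Ω_(m)` of the field of `Ω`, an operator on `V_Q ⊠ V_Q`. -/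
noncomputable def OmMode (ℓ : ℕ) (m : ℤ) : Module.End ℂ (VQ ℓ ⊗[ℂ] VQ ℓ) :=
  (stateField₂ ℓ (Om ℓ)).1 m

end LatticeVA

/-!
The proof rests on two facts about the operators `Ω_(m)`: for `m ≥ 0` they kill `|0⟩ ⊠ |0⟩`
(`OmMode_vac`), and they commute with `X ⊠ 1 + 1 ⊠ X` for all `X` in the affine Lie algebra
(`affineSpace_le_omCentralizer`). Formally `Z ⊠ Z = e^{X ⊠ 1 + 1 ⊠ X} (|0⟩ ⊠ |0⟩)`, so that `Ω_(m)`
kills it.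

For the commutation, the commutators of `h_(n)` with `E^{v_k}(z)` and `E^{-v_k}(z)` are the products
with `(h | v_k) z ^ n` and `-(h | v_k) z ^ n`, and the two contributions cancel. The commutator of
`E^α_(n)`, `α = v_k - v_l`, with `E^{±v_j}(z)` is nonzero only in `E^{v_l} ↦ ε(α, v_l) E^{v_k}` and
`E^{-v_k} ↦ ε(α, -v_k) E^{-v_l}`. Both produce the field `E^{v_k} ⊠ E^{-v_l}`, and the signs are
opposite.

The commutators of vertex operators (`expField_commutator`, `expField_commute`) are obtained without
the calculus of formal distributions. By `eq_zero_of_intertwining` a homogeneous family of operators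
with the same Heisenberg commutation relations as the `E^α_(p) E^β_(q)` vanishes once the images of
all `e^γ` have no constant terms: the `e^γ` generate `V_Q`, and a vector killed by the positive
modes is a combination of the `e^δ`. The constant terms of `E^α_(p) E^β_(q) e^γ` obey the recursion
`prodCoeff_succ` of the coefficients of `(z - w) ^ (α | β)`, which follows from the differential
equation of the exponential (`smul_expField_expVec`).

The series for `e^X |0⟩` converges only coefficient by coefficient, and perhaps only conditionally.
A coefficient of `Ω_(m) (x ⊠ y)` is a bilinear expression in finitely many coefficients of `x` and
`y` (`OmMode_coeff_finite`), so passing to the limit concerns Cauchy products of finitely many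
convergent series of complex numbers. These need not converge, but Abel's limit theorem gives what
is needed (`sum_mul_eq_zero_of_cauchy`).
-/

open scoped TensorProduct

namespace LatticeVA

variable {ℓ : ℕ}

/-! ### The Heisenberg operators -/

/-- The element `h s^{-(k+1)}` of the symmetric algebra `S`. -/
noncomputable def negGen (h : Car ℓ) (k : ℕ) : SymNeg ℓ := ∑ i, h i • MvPolynomial.X (i, k)

/-- The derivation of `S` by which `h s^{k+1}` acts, without its factor `k + 1`. -/
noncomputable def posDer (h : Car ℓ) (k : ℕ) : Derivation ℂ (SymNeg ℓ) (SymNeg ℓ) :=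
  ∑ i, h i • MvPolynomial.pderiv (i, k)

theorem posDer_apply (h : Car ℓ) (k : ℕ) (g : SymNeg ℓ) :
    posDer h k g = ∑ i, h i • MvPolynomial.pderiv (i, k) g := by
  have e : ∀ t : Finset (Fin ℓ), (∑ i ∈ t, h i • MvPolynomial.pderiv (R := ℂ) (i, k)) g =
      ∑ i ∈ t, h i • MvPolynomial.pderiv (i, k) g := by
    intro t
    induction t using Finset.cons_induction with
    | empty => simp
    | cons a t ha ih => rw [Finset.sum_cons, Finset.sum_cons, Derivation.add_apply, ih]; rfl
  exact e _

theorem heis_zero_single (h : Car ℓ) (β : Lat ℓ) (g : SymNeg ℓ) :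
    heis h 0 (Finsupp.single β g) = (∑ i, h i * (β i : ℂ)) • Finsupp.single β g := by
  change Finsupp.lsum ℂ _ _ = _
  rw [Finsupp.lsum_single]
  rfl

theorem heis_negSucc_single (h : Car ℓ) (k : ℕ) (β : Lat ℓ) (g : SymNeg ℓ) :
    heis h (Int.negSucc k) (Finsupp.single β g) = Finsupp.single β (negGen h k * g) := by
  change Finsupp.mapRange.linearMap _ _ = _
  rw [Finsupp.mapRange.linearMap_apply, Finsupp.mapRange_single]
  rfl

theorem heis_succ_single (h : Car ℓ) (k : ℕ) (β : Lat ℓ) (g : SymNeg ℓ) :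
    heis h ((k + 1 : ℕ) : ℤ) (Finsupp.single β g) =
      Finsupp.single β (((k : ℂ) + 1) • posDer h k g) := by
  change Finsupp.mapRange.linearMap _ _ = _
  rw [Finsupp.mapRange.linearMap_apply, Finsupp.mapRange_single, posDer_apply]
  simp [LinearMap.sum_apply]

/-- The extension of the bilinear form of `Q` to `𝔥`. -/
def carForm (h h' : Car ℓ) : ℂ := ∑ i, h i * h' i

theorem carForm_comm (h h' : Car ℓ) : carForm h h' = carForm h' h := by
  simp [carForm, mul_comm]

theorem posDer_negGen (h h' : Car ℓ) (j k : ℕ) :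
    posDer h j (negGen h' k) = if j = k then MvPolynomial.C (carForm h h') else 0 := by
  rw [posDer_apply, negGen]
  simp only [map_sum, Derivation.map_smul, MvPolynomial.pderiv_X]
  split_ifs with hjk
  · subst hjk
    rw [carForm, map_sum]
    refine Finset.sum_congr rfl fun i _ => ?_
    rw [Finset.sum_eq_single i]
    · simp [MvPolynomial.smul_eq_C_mul]
    · intro b _ hb
      rw [Pi.single_eq_of_ne (by simp [hb])]
      simp
    · simp
  · refine Finset.sum_eq_zero fun i _ => ?_
    rw [Finset.sum_eq_zero, smul_zero]
    intro b _
    rw [Pi.single_eq_of_ne (by simp [Ne.symm hjk]), smul_zero]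

theorem posDer_comm (h h' : Car ℓ) (j k : ℕ) (g : SymNeg ℓ) :
    posDer h j (posDer h' k g) = posDer h' k (posDer h j g) := by
  have e : ⁅posDer h j, posDer h' k⁆ = 0 := by
    refine MvPolynomial.derivation_ext fun i => ?_
    rw [Derivation.commutator_apply]
    have e1 : ∀ (h : Car ℓ) k, ∃ c, posDer h k (MvPolynomial.X i) = MvPolynomial.C c := by
      intro h k
      have := posDer_negGen h (Pi.single i.1 1) k i.2
      rw [negGen, Finset.sum_eq_single i.1 (by intro b _ hb; simp [hb]) (by simp)] at this
      simp only [Pi.single_eq_same, one_smul, Prod.mk.eta] at this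
      rw [this]
      split_ifs
      · exact ⟨_, rfl⟩
      · exact ⟨0, by simp⟩
    obtain ⟨c, hc⟩ := e1 h j
    obtain ⟨c', hc'⟩ := e1 h' k
    rw [hc, hc']
    simp [← MvPolynomial.algebraMap_eq]
  have := Derivation.congr_fun e g
  rw [Derivation.commutator_apply] at this
  exact sub_eq_zero.1 this

/-- The commutation relations of the Heisenberg algebra. -/
theorem heis_comm (h h' : Car ℓ) (m n : ℤ) (u : VQ ℓ) :
    heis h m (heis h' n u) =
      heis h' n (heis h m u) + (if m + n = 0 then (m : ℂ) * carForm h h' else 0) • u := by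
  induction u using Finsupp.induction_linear with
  | zero => simp
  | add u v hu hv => simp only [map_add, hu, hv, smul_add]; abel
  | single β g =>
    rcases m with (_ | j) | j <;> rcases n with (_ | k) | k
    · simp [heis_zero_single, smul_smul, mul_comm]
    · simp only [Int.ofNat_eq_natCast, Nat.cast_zero, heis_succ_single, heis_zero_single, map_smul]
      simp
    · simp only [Int.ofNat_eq_natCast, Nat.cast_zero, heis_negSucc_single, heis_zero_single,
        map_smul]
      simp
    · simp only [Int.ofNat_eq_natCast, Nat.cast_zero, heis_succ_single, heis_zero_single, map_smul]
      rw [if_neg (by omega)]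
      simp
    · simp only [Int.ofNat_eq_natCast, heis_succ_single, Derivation.map_smul]
      rw [if_neg (by omega), posDer_comm, smul_comm]
      simp
    · simp only [Int.ofNat_eq_natCast, heis_succ_single, heis_negSucc_single, Derivation.leibniz,
        posDer_negGen, mul_smul_comm, smul_add, smul_eq_mul, Finsupp.single_add,
        Finsupp.smul_single]
      congr 1
      by_cases hjk : j = k
      · subst hjk
        rw [if_pos rfl, if_pos (by omega)]
        congr 1
        rw [MvPolynomial.smul_eq_C_mul, MvPolynomial.smul_eq_C_mul]
        push_cast [map_mul]
        ring
      · rw [if_neg hjk, if_neg (by omega)]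
        simp
    · simp only [Int.ofNat_eq_natCast, Nat.cast_zero, heis_negSucc_single, heis_zero_single,
        map_smul]
      simp
    · simp only [Int.ofNat_eq_natCast, heis_succ_single, heis_negSucc_single, Derivation.leibniz,
        posDer_negGen, mul_smul_comm, smul_add, smul_eq_mul, Finsupp.single_add,
        Finsupp.smul_single]
      rw [add_assoc, left_eq_add, ← Finsupp.single_add]
      by_cases hjk : j = k
      · subst hjk
        rw [if_pos rfl, if_pos (by omega), carForm_comm]
        refine (congrArg (Finsupp.single β) ?_).trans (Finsupp.single_zero _)
        rw [MvPolynomial.smul_eq_C_mul, MvPolynomial.smul_eq_C_mul]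
        push_cast [map_mul, Int.negSucc_eq, map_neg]
        ring
      · rw [if_neg (Ne.symm hjk), if_neg (by omega)]
        simp
    · simp only [heis_negSucc_single]
      rw [if_neg (by omega), mul_left_comm]
      simp

/-- A vector killed by all `h_(k)`, `k > 0`, and without constant terms is zero. -/
theorem eq_zero_of_heis {u : VQ ℓ} (h1 : ∀ (h : Car ℓ) (k : ℕ), heis h ((k + 1 : ℕ) : ℤ) u = 0)
    (h2 : ∀ β, MvPolynomial.coeff 0 (u β) = 0) : u = 0 := by
  ext β s
  rw [Finsupp.zero_apply, MvPolynomial.coeff_zero]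
  by_cases hs : s = 0
  · rw [hs, h2]
  obtain ⟨p, hp⟩ := Finsupp.ne_iff.1 hs
  obtain ⟨i, k⟩ := p
  have e1 := DFunLike.congr_fun (h1 (Pi.single i 1) k) β
  change Finsupp.mapRange.linearMap _ _ _ = _ at e1
  rw [Finsupp.mapRange.linearMap_apply, Finsupp.mapRange_apply, LinearMap.smul_apply,
    LinearMap.sum_apply, Finset.sum_eq_single i (by intro b _ hb; simp [hb]) (by simp)] at e1
  simp only [Pi.single_eq_same, one_smul, Derivation.coeFn_coe,
    Finsupp.zero_apply] at e1
  have e2 := (smul_eq_zero.1 e1).resolve_left (by exact_mod_cast Nat.succ_ne_zero k)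
  have e3 := congrArg (MvPolynomial.coeff (s - Finsupp.single (i, k) 1)) e2
  rw [MvPolynomial.coeff_pderiv, tsub_add_cancel_of_le (by
    rw [Finsupp.single_le_iff]
    exact Nat.one_le_iff_ne_zero.2 hp), MvPolynomial.coeff_zero] at e3
  exact (mul_eq_zero.1 e3).resolve_right (Nat.cast_add_one_ne_zero _)

/-- The vectors `e^γ` generate `V_Q` under the operators `h_(-k)`, `k > 0`. -/
theorem eq_top_of_heis (W : Submodule ℂ (VQ ℓ)) (h1 : ∀ γ, expVec γ ∈ W)
    (h2 : ∀ (h : Car ℓ) (k : ℕ), ∀ u ∈ W, heis h (Int.negSucc k) u ∈ W) : W = ⊤ := by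
  refine Submodule.eq_top_iff'.2 fun u => ?_
  induction u using Finsupp.induction_linear with
  | zero => exact W.zero_mem
  | add u v hu hv => exact W.add_mem hu hv
  | single γ g =>
    induction g using MvPolynomial.induction_on with
    | C a =>
      have : (Finsupp.single γ (MvPolynomial.C a) : VQ ℓ) = a • expVec γ := by
        rw [expVec, Finsupp.smul_single, MvPolynomial.smul_eq_C_mul, mul_one]
      rw [this]
      exact W.smul_mem _ (h1 γ)
    | add p q hp hq =>
      rw [Finsupp.single_add]
      exact W.add_mem hp hq
    | mul_X p i hp =>
      have := h2 (Pi.single i.1 1) i.2 _ hp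
      rwa [heis_negSucc_single, negGen,
        Finset.sum_eq_single i.1 (by intro b _ hb; simp [hb]) (by simp), Pi.single_eq_same,
        one_smul, mul_comm] at this

/-! ### The grading of the space of states -/

/-- The vectors `g ⊗ e^γ` with `g` homogeneous of degree `d`, where `v_i s^{-m}` has degree `m`. -/
noncomputable def gr (γ : Lat ℓ) (d : ℤ) : Submodule ℂ (VQ ℓ) :=
  (MvPolynomial.weightedHomogeneousSubmodule ℂ (fun p : Fin ℓ × ℕ => (p.2 : ℤ) + 1) d).map
    (Finsupp.lsingle γ)

theorem weight_eq_wt (s : Fin ℓ × ℕ →₀ ℕ) :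
    Finsupp.weight (fun p : Fin ℓ × ℕ => (p.2 : ℤ) + 1) s = wt s := by
  simp [Finsupp.weight_apply, wt]

theorem single_mem_gr {γ : Lat ℓ} {d : ℤ} {g : SymNeg ℓ}
    (hg : g.IsWeightedHomogeneous (fun p : Fin ℓ × ℕ => (p.2 : ℤ) + 1) d) :
    (Finsupp.single γ g : VQ ℓ) ∈ gr γ d :=
  Submodule.mem_map_of_mem (f := Finsupp.lsingle γ) hg

theorem monomial_mem_gr (γ : Lat ℓ) (s : Fin ℓ × ℕ →₀ ℕ) :
    (Finsupp.single γ (MvPolynomial.monomial s 1) : VQ ℓ) ∈ gr γ (wt s) :=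
  single_mem_gr (MvPolynomial.isWeightedHomogeneous_monomial _ _ _ (weight_eq_wt s))

theorem expVec_mem_gr (γ : Lat ℓ) : expVec γ ∈ gr γ 0 :=
  single_mem_gr (MvPolynomial.isWeightedHomogeneous_one _ _)

theorem coeff_eq_zero_of_mem_gr {γ : Lat ℓ} {d : ℤ} {u : VQ ℓ} (hu : u ∈ gr γ d) {δ : Lat ℓ}
    {s : Fin ℓ × ℕ →₀ ℕ} (h : γ ≠ δ ∨ wt s ≠ d) : MvPolynomial.coeff s (u δ) = 0 := by
  obtain ⟨g, hg, rfl⟩ := hu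
  rw [Finsupp.lsingle_apply]
  rcases h with h | h
  · rw [Finsupp.single_eq_of_ne h.symm]
    simp
  · by_cases hd : γ = δ
    · subst hd
      rw [Finsupp.single_eq_same]
      refine MvPolynomial.IsWeightedHomogeneous.coeff_eq_zero hg s ?_
      rwa [weight_eq_wt]
    · rw [Finsupp.single_eq_of_ne (Ne.symm hd)]
      simp

theorem gr_neg {γ : Lat ℓ} {d : ℤ} (hd : d < 0) {u : VQ ℓ} (hu : u ∈ gr γ d) : u = 0 := by
  ext β s
  rw [coeff_eq_zero_of_mem_gr hu (Or.inr (by have := wt_nonneg s; omega))]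
  simp

theorem heis_mem_gr (h : Car ℓ) (n : ℤ) {γ : Lat ℓ} {d : ℤ} {u : VQ ℓ} (hu : u ∈ gr γ d) :
    heis h n u ∈ gr γ (d - n) := by
  obtain ⟨g, hg, rfl⟩ := hu
  rw [Finsupp.lsingle_apply]
  rcases n with (_ | k) | k
  · simp only [Int.ofNat_eq_natCast, Nat.cast_zero, sub_zero]
    rw [heis_zero_single]
    exact Submodule.smul_mem _ _ (single_mem_gr hg)
  · simp only [Int.ofNat_eq_natCast]
    rw [heis_succ_single]
    refine single_mem_gr (Submodule.smul_mem
      (MvPolynomial.weightedHomogeneousSubmodule ℂ _ _) _ ?_)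
    rw [posDer_apply]
    refine Submodule.sum_mem _ fun i _ => Submodule.smul_mem _ _ ?_
    exact MvPolynomial.IsWeightedHomogeneous.pderiv hg (by push_cast; ring)
  · rw [heis_negSucc_single]
    refine single_mem_gr ?_
    have e : d - Int.negSucc k = ((k : ℤ) + 1) + d := by omega
    rw [e]
    refine MvPolynomial.IsWeightedHomogeneous.mul ?_ hg
    refine Submodule.sum_mem (MvPolynomial.weightedHomogeneousSubmodule ℂ _ _)
      fun i _ => Submodule.smul_mem _ _ ?_
    exact MvPolynomial.isWeightedHomogeneous_X ℂ _ (i, k)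

theorem heis_expVec (h : Car ℓ) {n : ℤ} (hn : 0 < n) (γ : Lat ℓ) : heis h n (expVec γ) = 0 :=
  gr_neg (by omega) (heis_mem_gr h n (expVec_mem_gr γ))

/-! ### Commutation with exponentials of series of operators -/

section ExpCoeff

variable {R : Type*} [Ring R] [Algebra ℂ R]

theorem expCoeff_zero (A : PowerSeries R) : expCoeff A 0 = 1 := by
  simp [expCoeff]

theorem coeff_pow_eq_zero {R : Type*} [Ring R] {A : PowerSeries R} (hA : PowerSeries.coeff 0 A = 0)
    {n k : ℕ}
    (h : k < n) : PowerSeries.coeff k (A ^ n) = 0 := by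
  induction n generalizing k with
  | zero => omega
  | succ n ih =>
    rw [pow_succ, PowerSeries.coeff_mul]
    refine Finset.sum_eq_zero fun p hp => ?_
    rw [Finset.HasAntidiagonal.mem_antidiagonal] at hp
    by_cases h2 : p.2 = 0
    · rw [h2, hA, mul_zero]
    · rw [ih (by omega), zero_mul]

/-- `[T, A(z)] = c z ^ r` implies `[T, A(z) ^ n] = n c z ^ r A(z) ^ (n - 1)`. -/
theorem C_mul_pow {A : PowerSeries R} {T : R} {r : ℕ} {c : ℂ}
    (h : PowerSeries.C T * A = A * PowerSeries.C T + PowerSeries.X ^ r * algebraMap ℂ _ c) (n : ℕ) :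
    PowerSeries.C T * A ^ n = A ^ n * PowerSeries.C T +
      PowerSeries.X ^ r * (((n : ℂ) * c) • A ^ (n - 1)) := by
  induction n with
  | zero => simp
  | succ n ih =>
    rw [pow_succ, ← mul_assoc, ih, add_mul, mul_assoc, h, mul_add, ← mul_assoc, add_assoc]
    congr 1
    rw [mul_assoc (PowerSeries.X ^ r), ← mul_assoc (A ^ n), ← PowerSeries.X_pow_mul, mul_assoc,
      ← mul_add]
    congr 1
    rw [← Algebra.commutes, ← Algebra.smul_def, smul_mul_assoc, Nat.add_sub_cancel]
    rcases n with - | n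
    · simp
    · rw [Nat.add_sub_cancel, ← pow_succ, ← add_smul]
      congr 1
      push_cast
      ring

/-- If `T` commutes with all coefficients of `A(z)` up to the scalar `c` at `z ^ r`, then the
commutator of `T` with `exp A(z)` is `c z ^ r exp A(z)`. -/
theorem mul_expCoeff {A : PowerSeries R} (hA : PowerSeries.coeff 0 A = 0) {T : R} {r : ℕ}
    (hr : r ≠ 0) {c : ℂ}
    (h : ∀ j, T * PowerSeries.coeff j A =
      PowerSeries.coeff j A * T + if j = r then algebraMap ℂ R c else 0) (k : ℕ) :
    T * expCoeff A k = expCoeff A k * T + if r ≤ k then c • expCoeff A (k - r) else 0 := by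
  have h1 : PowerSeries.C T * A = A * PowerSeries.C T +
      PowerSeries.X ^ r * algebraMap ℂ (PowerSeries R) c := by
    ext j
    have e : algebraMap ℂ (PowerSeries R) c = PowerSeries.C (algebraMap ℂ R c) :=
      PowerSeries.algebraMap_apply
    rw [map_add, PowerSeries.coeff_C_mul, PowerSeries.coeff_mul_C, h, e, PowerSeries.coeff_mul_C,
      PowerSeries.coeff_X_pow]
    split_ifs <;> simp
  have h2 : ∀ n : ℕ, T * PowerSeries.coeff k (A ^ n) = PowerSeries.coeff k (A ^ n) * T +
      if r ≤ k then ((n : ℂ) * c) • PowerSeries.coeff (k - r) (A ^ (n - 1)) else 0 := by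
    intro n
    have := congrArg (PowerSeries.coeff k) (C_mul_pow h1 n)
    rw [map_add, PowerSeries.coeff_C_mul, PowerSeries.coeff_mul_C,
      PowerSeries.coeff_X_pow_mul'] at this
    rw [this]
    simp
  simp only [expCoeff, Finset.mul_sum, Finset.sum_mul, mul_smul_comm, smul_mul_assoc, h2, smul_add,
    Finset.sum_add_distrib]
  congr 1
  split_ifs with hrk
  · rw [Finset.sum_range_succ', Finset.smul_sum]
    simp only [Nat.cast_zero, zero_mul, zero_smul, smul_zero, add_zero, Nat.add_sub_cancel]
    rw [← Finset.sum_subset (Finset.range_subset_range.2 (show k - r + 1 ≤ k by omega))]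
    · refine Finset.sum_congr rfl fun n _ => ?_
      rw [smul_smul, smul_smul]
      congr 1
      have : (n.factorial : ℂ) ≠ 0 := by exact_mod_cast n.factorial_ne_zero
      have : (n : ℂ) + 1 ≠ 0 := Nat.cast_add_one_ne_zero n
      rw [Nat.factorial_succ]
      push_cast
      field_simp
    · intro n _ hn
      rw [Finset.mem_range] at hn
      rw [coeff_pow_eq_zero hA (by omega), smul_zero, smul_zero]
  · simp

/-- The coefficients of `exp A(z)`, extended by zero to negative indices. -/
noncomputable def expCoeffInt (A : PowerSeries R) : ℤ → R
  | Int.ofNat k => expCoeff A k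
  | Int.negSucc _ => 0

theorem expCoeffInt_of_neg (A : PowerSeries R) {k : ℤ} (hk : k < 0) : expCoeffInt A k = 0 := by
  obtain ⟨n, rfl⟩ := Int.eq_negSucc_of_lt_zero hk
  rfl

theorem expCoeffInt_of_nonneg (A : PowerSeries R) {k : ℤ} (hk : 0 ≤ k) :
    expCoeffInt A k = expCoeff A k.toNat := by
  obtain ⟨n, rfl⟩ := Int.eq_ofNat_of_zero_le hk
  rfl

theorem mul_expCoeffInt {A : PowerSeries R} (hA : PowerSeries.coeff 0 A = 0) {T : R} {r : ℕ}
    (hr : r ≠ 0) {c : ℂ}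
    (h : ∀ j, T * PowerSeries.coeff j A =
      PowerSeries.coeff j A * T + if j = r then algebraMap ℂ R c else 0) (k : ℤ) :
    T * expCoeffInt A k = expCoeffInt A k * T + c • expCoeffInt A (k - r) := by
  rcases lt_or_ge k 0 with hk | hk
  · rw [expCoeffInt_of_neg _ hk, expCoeffInt_of_neg _ (by omega)]
    simp
  · rw [expCoeffInt_of_nonneg _ hk, mul_expCoeff hA hr h]
    congr 1
    split_ifs with h1
    · rw [expCoeffInt_of_nonneg _ (by omega)]
      congr 2
      omega
    · rw [expCoeffInt_of_neg _ (by omega), smul_zero]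

end ExpCoeff

/-! ### The modes of the fields `E^α(z)` -/

/-- The coefficient of `z ^ j` in `exp (∑_{n > 0} α_(-n) z ^ n / n)`, for `j ∈ ℤ`. -/
noncomputable def expPosInt (α : Lat ℓ) : ℤ → Module.End ℂ (VQ ℓ) :=
  expCoeffInt (PowerSeries.mk fun n : ℕ =>
    if n = 0 then 0 else ((n : ℂ)⁻¹) • heis (latToCar α) (-(n : ℤ)))

/-- The coefficient of `z ^ (-k)` in `exp (-∑_{n > 0} α_(n) z ^ (-n) / n)`, for `k ∈ ℤ`. -/
noncomputable def expNegInt (α : Lat ℓ) : ℤ → Module.End ℂ (VQ ℓ) :=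
  expCoeffInt (PowerSeries.mk fun n : ℕ =>
    if n = 0 then 0 else (-(n : ℂ)⁻¹) • heis (latToCar α) (n : ℤ))

/-- Only `h_(n)` with `n > 0` fails to commute with the creation part, and `[h_(n), α_(-n) / n]` is
`(h | α)`. -/
theorem heis_expPosInt (h : Car ℓ) (α : Lat ℓ) (n j : ℤ) (u : VQ ℓ) :
    heis h n (expPosInt α j u) = expPosInt α j (heis h n u) +
      (if 0 < n then carForm h (latToCar α) else 0) • expPosInt α (j - n) u := by
  by_cases hn : 0 < n
  · obtain ⟨r, rfl⟩ := Int.eq_ofNat_of_zero_le hn.le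
    rw [if_pos hn]
    refine LinearMap.congr_fun (mul_expCoeffInt (T := heis h (r : ℤ)) (r := r) ?_ (by omega) ?_ j) u
    · simp
    · intro i
      rw [PowerSeries.coeff_mk]
      by_cases hi : i = 0
      · rw [if_pos hi, if_neg (by omega)]
        simp
      · refine LinearMap.ext fun v => ?_
        rw [if_neg hi]
        simp only [Module.End.mul_apply, LinearMap.add_apply, LinearMap.smul_apply, map_smul,
          heis_comm h, smul_add]
        congr 1
        by_cases hir : i = r
        · subst hir
          have : (i : ℂ) ≠ 0 := by exact_mod_cast hi
          simp only [add_neg_cancel, if_true, Int.cast_natCast, Module.algebraMap_end_apply,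
            smul_smul]
          rw [inv_mul_cancel_left₀ this]
        · rw [if_neg (by omega), if_neg hir]
          simp
  · rw [if_neg hn]
    refine LinearMap.congr_fun (mul_expCoeffInt (T := heis h n) (r := 1) (c := 0) ?_
      (by omega) ?_ j) u |>.trans ?_
    · simp
    · intro i
      rw [PowerSeries.coeff_mk]
      by_cases hi : i = 0
      · rw [if_pos hi]
        simp
      · refine LinearMap.ext fun v => ?_
        rw [if_neg hi]
        simp only [Module.End.mul_apply, LinearMap.add_apply, LinearMap.smul_apply, map_smul,
          heis_comm h, smul_add]
        rw [if_neg (by omega)]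
        simp
    · simp [expPosInt]

theorem heis_expNegInt (h : Car ℓ) (α : Lat ℓ) (n k : ℤ) (u : VQ ℓ) :
    heis h n (expNegInt α k u) = expNegInt α k (heis h n u) +
      (if n < 0 then carForm h (latToCar α) else 0) • expNegInt α (k + n) u := by
  by_cases hn : n < 0
  · obtain ⟨r, hr⟩ := Int.eq_ofNat_of_zero_le (show 0 ≤ -n by omega)
    obtain rfl : n = -(r : ℤ) := by omega
    rw [if_pos hn]
    refine LinearMap.congr_fun (mul_expCoeffInt (T := heis h (-(r : ℤ))) (r := r) ?_
      (by omega) ?_ k) u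
    · simp
    · intro i
      rw [PowerSeries.coeff_mk]
      by_cases hi : i = 0
      · rw [if_pos hi, if_neg (by omega)]
        simp
      · refine LinearMap.ext fun v => ?_
        rw [if_neg hi]
        simp only [Module.End.mul_apply, LinearMap.add_apply, LinearMap.smul_apply, map_smul,
          heis_comm h, smul_add]
        congr 1
        by_cases hir : i = r
        · subst hir
          have : (i : ℂ) ≠ 0 := by exact_mod_cast hi
          simp only [neg_add_cancel, if_true, Int.cast_natCast, Int.cast_neg,
            Module.algebraMap_end_apply, smul_smul]
          rw [← mul_assoc, neg_mul_neg, inv_mul_cancel₀ this, one_mul]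
        · rw [if_neg (by omega), if_neg hir]
          simp
  · rw [if_neg hn]
    refine LinearMap.congr_fun (mul_expCoeffInt (T := heis h n) (r := 1) (c := 0) ?_
      (by omega) ?_ k) u |>.trans ?_
    · simp
    · intro i
      rw [PowerSeries.coeff_mk]
      by_cases hi : i = 0
      · rw [if_pos hi]
        simp
      · refine LinearMap.ext fun v => ?_
        rw [if_neg hi]
        simp only [Module.End.mul_apply, LinearMap.add_apply, LinearMap.smul_apply, map_smul,
          heis_comm h, smul_add]
        rw [if_neg (by omega)]
        simp
    · simp [expNegInt]

theorem shiftOp_single (α β : Lat ℓ) (g : SymNeg ℓ) :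
    shiftOp α (Finsupp.single β g) =
      (((eps α β : ℤˣ) : ℤ) : ℂ) • Finsupp.single (α + β) g := by
  rw [shiftOp, Finsupp.lsum_single]
  rfl

theorem heis_shiftOp (h : Car ℓ) (α : Lat ℓ) (n : ℤ) (u : VQ ℓ) :
    heis h n (shiftOp α u) = shiftOp α (heis h n u) +
      (if n = 0 then carForm h (latToCar α) else 0) • shiftOp α u := by
  induction u using Finsupp.induction_linear with
  | zero => simp
  | add u v hu hv => simp only [map_add, hu, hv, smul_add]; abel
  | single β g =>
    rcases n with (_ | j) | j
    · simp only [Int.ofNat_eq_natCast, Nat.cast_zero, heis_zero_single, shiftOp_single, map_smul,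
        if_true]
      rw [smul_smul, smul_smul, smul_smul, ← add_smul]
      congr 1
      simp only [carForm, latToCar, Pi.add_apply, Int.cast_add, mul_add, Finset.sum_add_distrib]
      ring
    · simp only [Int.ofNat_eq_natCast, heis_succ_single, shiftOp_single, map_smul]
      rw [if_neg (by omega)]
      simp
    · simp only [heis_negSucc_single, shiftOp_single, map_smul]
      simp

theorem expCoeffInt_mem_gr {A : PowerSeries (Module.End ℂ (VQ ℓ))} (σ : ℤ)
    (hA : ∀ (j : ℕ) (γ : Lat ℓ) (d : ℤ), ∀ u ∈ gr γ d, PowerSeries.coeff j A u ∈ gr γ (d + σ * j))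
    (k : ℤ) {γ : Lat ℓ} {d : ℤ} {u : VQ ℓ} (hu : u ∈ gr γ d) :
    expCoeffInt A k u ∈ gr γ (d + σ * k) := by
  rcases lt_or_ge k 0 with hk | hk
  · rw [expCoeffInt_of_neg _ hk]
    exact Submodule.zero_mem _
  obtain ⟨k, rfl⟩ := Int.eq_ofNat_of_zero_le hk
  have key : ∀ n k : ℕ, ∀ d : ℤ, ∀ u ∈ gr γ d,
      PowerSeries.coeff k (A ^ n) u ∈ gr γ (d + σ * k) := by
    intro n
    induction n with
    | zero =>
      intro k d u hu
      rw [pow_zero, PowerSeries.coeff_one]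
      split_ifs with h
      · subst h
        simpa using hu
      · simp
    | succ n ih =>
      intro k d u hu
      rw [pow_succ, PowerSeries.coeff_mul, LinearMap.sum_apply]
      refine Submodule.sum_mem _ fun p hp => ?_
      rw [Finset.HasAntidiagonal.mem_antidiagonal] at hp
      have e : d + σ * (k : ℤ) = d + σ * p.2 + σ * p.1 := by
        rw [← hp]
        push_cast
        ring
      rw [Module.End.mul_apply, e]
      exact ih _ _ _ (hA _ _ _ _ hu)
  change expCoeff A k u ∈ _
  rw [expCoeff, LinearMap.sum_apply]
  exact Submodule.sum_mem _ fun n _ => Submodule.smul_mem _ _ (key n k d u hu)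

theorem expPosInt_mem_gr (α : Lat ℓ) (j : ℤ) {γ : Lat ℓ} {d : ℤ} {u : VQ ℓ} (hu : u ∈ gr γ d) :
    expPosInt α j u ∈ gr γ (d + j) := by
  rw [← one_mul j, show expPosInt α (1 * j) = expPosInt α j by rw [one_mul]]
  refine expCoeffInt_mem_gr 1 (fun j γ d u hu => ?_) j hu
  rw [PowerSeries.coeff_mk]
  split_ifs
  · exact Submodule.zero_mem _
  · refine Submodule.smul_mem _ _ ?_
    convert heis_mem_gr _ _ hu using 1
    ring_nf

theorem expNegInt_mem_gr (α : Lat ℓ) (j : ℤ) {γ : Lat ℓ} {d : ℤ} {u : VQ ℓ} (hu : u ∈ gr γ d) :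
    expNegInt α j u ∈ gr γ (d - j) := by
  rw [sub_eq_add_neg, ← neg_one_mul]
  refine expCoeffInt_mem_gr (-1) (fun j γ d u hu => ?_) j hu
  rw [PowerSeries.coeff_mk]
  split_ifs
  · exact Submodule.zero_mem _
  · refine Submodule.smul_mem _ _ ?_
    convert heis_mem_gr _ _ hu using 1
    ring_nf

theorem shiftOp_mem_gr (α : Lat ℓ) {γ : Lat ℓ} {d : ℤ} {u : VQ ℓ} (hu : u ∈ gr γ d) :
    shiftOp α u ∈ gr (α + γ) d := by
  obtain ⟨g, hg, rfl⟩ := hu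
  rw [Finsupp.lsingle_apply, shiftOp_single]
  exact Submodule.smul_mem _ _ (single_mem_gr hg)

theorem vertexTerm_finite (α : Lat ℓ) (c : ℤ) (u : VQ ℓ) : (Function.support fun k : ℤ =>
    shiftOp α (expPosInt α (k - c) (expNegInt α k u))).Finite := by
  obtain ⟨K, hK⟩ := expNeg_eq_zero α u
  refine (Set.finite_Ico 0 (K : ℤ)).subset fun k hk => ?_
  by_contra hcon
  apply hk
  change shiftOp α (expPosInt α (k - c) (expNegInt α k u)) = 0
  have : expNegInt α k u = 0 := by
    rcases lt_or_ge k 0 with h | h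
    · rw [expNegInt, expCoeffInt_of_neg _ h]
      rfl
    · rw [expNegInt, expCoeffInt_of_nonneg _ h]
      simp only [Set.mem_Ico, not_and, not_lt] at hcon
      exact hK _ (by have := hcon h; omega)
  rw [this, map_zero, map_zero]

/-- The coefficient of `z ^ (-c)` in `e^α exp(∑_{n > 0} α_(-n) z ^ n / n)
exp(-∑_{n > 0} α_(n) z ^ (-n) / n)`. It differs from `E^α(z)` by the absence of `z ^ {α_(0)}`. -/
noncomputable def vertexCoeff (α : Lat ℓ) (c : ℤ) : Module.End ℂ (VQ ℓ) :=
  lfSum (fun k : ℤ => shiftOp α * expPosInt α (k - c) * expNegInt α k) (vertexTerm_finite α c)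

theorem vertexCoeff_apply (α : Lat ℓ) (c : ℤ) (u : VQ ℓ) : vertexCoeff α c u =
    ∑ᶠ k : ℤ, shiftOp α (expPosInt α (k - c) (expNegInt α k u)) := rfl

theorem heis_vertexCoeff (h : Car ℓ) (α : Lat ℓ) (n c : ℤ) (u : VQ ℓ) :
    heis h n (vertexCoeff α c u) = vertexCoeff α c (heis h n u) +
      carForm h (latToCar α) • vertexCoeff α (c + n) u := by
  rw [vertexCoeff_apply, map_finsum _ (vertexTerm_finite α c u), vertexCoeff_apply α c (heis h n u),
    vertexCoeff_apply α (c + n), smul_finsum' _ (vertexTerm_finite α (c + n) u)]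
  have fin1 : (Function.support fun k : ℤ => carForm h (latToCar α) •
      shiftOp α (expPosInt α (k - (c + n)) (expNegInt α k u))).Finite :=
    (vertexTerm_finite α (c + n) u).subset
      (Function.support_const_smul_subset (carForm h (latToCar α)) fun k : ℤ =>
        shiftOp α (expPosInt α (k - (c + n)) (expNegInt α k u)))
  rcases lt_trichotomy n 0 with hn | rfl | hn
  · have e : ∀ k, heis h n (shiftOp α (expPosInt α (k - c) (expNegInt α k u))) =
        shiftOp α (expPosInt α (k - c) (expNegInt α k (heis h n u))) +
        carForm h (latToCar α) •
          shiftOp α (expPosInt α (k + n - (c + n)) (expNegInt α (k + n) u)) := by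
      intro k
      rw [heis_shiftOp, heis_expPosInt, heis_expNegInt, if_neg hn.ne, if_neg hn.not_gt, if_pos hn,
        add_sub_add_right_eq_sub]
      simp
    rw [finsum_congr e, finsum_add_distrib (vertexTerm_finite α c (heis h n u)),
      ← finsum_comp_equiv (Equiv.addRight n)
        (f := fun k => carForm h (latToCar α) •
          shiftOp α (expPosInt α (k - (c + n)) (expNegInt α k u)))]
    · rfl
    · exact fin1.preimage ((Equiv.addRight n).injective.injOn)
  · rw [← finsum_add_distrib (vertexTerm_finite α c _) fin1]
    refine finsum_congr fun k => ?_
    rw [heis_shiftOp, heis_expPosInt, heis_expNegInt]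
    simp
  · rw [← finsum_add_distrib (vertexTerm_finite α c _) fin1]
    refine finsum_congr fun k => ?_
    rw [heis_shiftOp, heis_expPosInt, heis_expNegInt, if_pos hn, if_neg hn.not_gt, if_neg hn.ne',
      sub_sub]
    simp

theorem vertexCoeff_mem_gr (α : Lat ℓ) (c : ℤ) {γ : Lat ℓ} {d : ℤ} {u : VQ ℓ} (hu : u ∈ gr γ d) :
    vertexCoeff α c u ∈ gr (α + γ) (d - c) := by
  rw [vertexCoeff_apply]
  refine finsum_induction (· ∈ gr (α + γ) (d - c)) (Submodule.zero_mem _)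
    (fun _ _ => Submodule.add_mem _) fun k => ?_
  have := shiftOp_mem_gr α (expPosInt_mem_gr α (k - c) (expNegInt_mem_gr α k hu))
  rwa [show d - k + (k - c) = d - c by ring] at this

theorem vertexCoeff_zero_expVec (α γ : Lat ℓ) :
    vertexCoeff α 0 (expVec γ) = (((eps α γ : ℤˣ) : ℤ) : ℂ) • expVec (α + γ) := by
  rw [vertexCoeff_apply, finsum_eq_single _ 0]
  · rw [sub_zero, expPosInt, expNegInt, expCoeffInt_of_nonneg _ le_rfl,
      expCoeffInt_of_nonneg _ le_rfl]
    rw [Int.toNat_zero, expCoeff_zero, expCoeff_zero]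
    exact shiftOp_single _ _ _
  · intro k hk
    rcases lt_or_gt_of_ne hk with h | h
    · rw [expNegInt, expCoeffInt_of_neg _ h]
      simp
    · rw [gr_neg (by omega) (expNegInt_mem_gr α k (expVec_mem_gr γ)), map_zero, map_zero]

/-- On `g ⊗ e^γ`, the factor `z ^ {α_(0)}` of `E^α(z)` is `z ^ (α | γ)`. -/
theorem expField_single (α : Lat ℓ) (m : ℤ) (γ : Lat ℓ) (g : SymNeg ℓ) :
    (expField α).1 m (Finsupp.single γ g) =
      vertexCoeff α (m + 1 + latForm α γ) (Finsupp.single γ g) := by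
  set u : VQ ℓ := Finsupp.single γ g with hu
  set c := m + 1 + latForm α γ with hc
  change ∑ᶠ p : ℕ × ℕ, expTerm α m p u = _
  rw [vertexCoeff_apply]
  have e1 : ∀ p : ℕ × ℕ, expTerm α m p u = ∑ᶠ _ : p ∈ {p : ℕ × ℕ | (p.1 : ℤ) = p.2 - c},
      shiftOp α (expPos α p.1 (expNeg α p.2 u)) := by
    intro p
    change shiftOp α (expPos α p.1 (expNeg α p.2 (zeroModeProj α (-m - 1 - p.1 + p.2) u))) = _
    rw [zeroModeProj, hu, Finsupp.lsum_single]
    by_cases hp : (p.1 : ℤ) = p.2 - c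
    · rw [if_pos (by omega), finsum_eq_if, if_pos (show p ∈ _ from hp)]
      rfl
    · rw [if_neg (by omega), finsum_eq_if, if_neg (show p ∉ _ from hp)]
      simp
  have e2 : ∀ k : ℤ, shiftOp α (expPosInt α (k - c) (expNegInt α k u)) =
      ∑ᶠ _ : k ∈ {k : ℤ | 0 ≤ k ∧ 0 ≤ k - c},
        shiftOp α (expPosInt α (k - c) (expNegInt α k u)) := by
    intro k
    rw [finsum_eq_if]
    split_ifs with hk
    · rfl
    · simp only [Set.mem_ofPred_eq, not_and_or, not_le] at hk
      rcases hk with hk | hk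
      · rw [expNegInt, expCoeffInt_of_neg _ hk]
        simp
      · rw [expPosInt, expCoeffInt_of_neg _ hk]
        simp
  rw [finsum_congr e1, finsum_congr e2]
  -- The power of `z` in `z ^ {α_(0)}` determines `p.1` from `p.2`.
  refine finsum_mem_eq_of_bijOn (fun p => (p.2 : ℤ)) ⟨?_, ?_, ?_⟩ ?_
  · rintro ⟨a, b⟩ h
    simp only [Set.mem_ofPred_eq] at h ⊢
    omega
  · rintro ⟨a, b⟩ h ⟨a', b'⟩ h' hab
    simp only [Set.mem_ofPred_eq, Prod.mk.injEq] at h h' hab ⊢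
    omega
  · rintro k ⟨h1, h2⟩
    exact ⟨((k - c).toNat, k.toNat), by simp only [Set.mem_ofPred_eq]; omega, by simp; omega⟩
  · rintro ⟨a, b⟩ h
    simp only [Set.mem_ofPred_eq] at h
    rw [← h]
    rfl

/-- `[h_(n), E^α_(m)] = (h | α) E^α_(m+n)`. -/
theorem heis_expField (h : Car ℓ) (α : Lat ℓ) (n m : ℤ) (u : VQ ℓ) :
    heis h n ((expField α).1 m u) = (expField α).1 m (heis h n u) +
      carForm h (latToCar α) • (expField α).1 (m + n) u := by
  induction u using Finsupp.induction_linear with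
  | zero => simp
  | add u v hu hv => simp only [map_add, hu, hv, smul_add]; abel
  | single γ g =>
    have e : ∃ g', heis h n (Finsupp.single γ g) = Finsupp.single γ g' := by
      rcases n with (_ | j) | j
      · exact ⟨_, (heis_zero_single _ _ _).trans (Finsupp.smul_single _ _ _)⟩
      · exact ⟨_, heis_succ_single _ _ _ _⟩
      · exact ⟨_, heis_negSucc_single _ _ _ _⟩
    obtain ⟨g', hg'⟩ := e
    rw [hg', expField_single, expField_single, expField_single, heis_vertexCoeff, hg']
    congr 3
    ring_nf

theorem expField_mem_gr (α : Lat ℓ) (m : ℤ) {γ : Lat ℓ} {d : ℤ} {u : VQ ℓ} (hu : u ∈ gr γ d) :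
    (expField α).1 m u ∈ gr (α + γ) (d - (m + 1 + latForm α γ)) := by
  obtain ⟨g, hg, rfl⟩ := hu
  rw [Finsupp.lsingle_apply, expField_single]
  exact vertexCoeff_mem_gr _ _ (single_mem_gr hg)

theorem expField_expVec (α γ : Lat ℓ) :
    (expField α).1 (-1 - latForm α γ) (expVec γ) =
      (((eps α γ : ℤˣ) : ℤ) : ℂ) • expVec (α + γ) := by
  rw [← vertexCoeff_zero_expVec, expVec, expField_single]
  congr 2
  ring

/-! ### The form and the cocycle -/

theorem carForm_latToCar (α β : Lat ℓ) :
    carForm (latToCar α) (latToCar β) = (latForm α β : ℂ) := by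
  simp [carForm, latToCar, latForm]

theorem latForm_add_left (α α' β : Lat ℓ) :
    latForm (α + α') β = latForm α β + latForm α' β := by
  simp [latForm, add_mul, Finset.sum_add_distrib]

theorem latForm_comm (α β : Lat ℓ) : latForm α β = latForm β α := by
  simp [latForm, mul_comm]

theorem latForm_add_right (α β β' : Lat ℓ) :
    latForm α (β + β') = latForm α β + latForm α β' := by
  rw [latForm_comm, latForm_add_left, latForm_comm β, latForm_comm β']

theorem eps_add_left (α α' β : Lat ℓ) : eps (α + α') β = eps α β * eps α' β := by
  simp [eps, add_mul, zpow_add, Finset.prod_mul_distrib]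

theorem eps_add_right (α β β' : Lat ℓ) : eps α (β + β') = eps α β * eps α β' := by
  simp [eps, mul_add, zpow_add, Finset.prod_mul_distrib]

/-! ### Products of two vertex operators -/

/-- The functional of the constant term is invariant under the creation operators. -/
theorem coeff_zero_heis_neg (h : Car ℓ) {n : ℤ} (hn : n < 0) (u : VQ ℓ) (δ : Lat ℓ) :
    MvPolynomial.coeff 0 (heis h n u δ) = 0 := by
  obtain ⟨k, rfl⟩ := Int.eq_negSucc_of_lt_zero hn
  change MvPolynomial.coeff 0 (Finsupp.mapRange.linearMap _ _ _) = _
  rw [Finsupp.mapRange.linearMap_apply, Finsupp.mapRange_apply, LinearMap.mulLeft_apply,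
    ← MvPolynomial.constantCoeff_eq, map_mul, map_sum]
  simp [MvPolynomial.smul_eq_C_mul]

theorem expField_expVec_eq_zero (α γ : Lat ℓ) {m : ℤ} (hm : -1 - latForm α γ < m) :
    (expField α).1 m (expVec γ) = 0 :=
  gr_neg (by omega) (expField_mem_gr α m (expVec_mem_gr γ))

/-- The coefficient of `z ^ (j - 1)` in the differential equation `∂F(z) = α(z)_{≥0} F(z)` of
`F(z) = z ^ {-(α | γ)} E^α(z) e^γ`. Both sides have the same images under the positive Heisenberg
modes, by the same equation for smaller `j`, and no constant terms. -/
theorem smul_expField_expVec (α γ : Lat ℓ) (j : ℕ) :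
    (j : ℂ) • (expField α).1 (-1 - latForm α γ - j) (expVec γ) =
      ∑ i ∈ Finset.range j, heis (latToCar α) ((i : ℤ) - j)
        ((expField α).1 (-1 - latForm α γ - i) (expVec γ)) := by
  obtain ⟨x, hx⟩ : ∃ x : ℤ → VQ ℓ,
      ∀ i, (expField α).1 (-1 - latForm α γ - i) (expVec γ) = x i := ⟨_, fun _ => rfl⟩
  have x_neg : ∀ i < 0, x i = 0 := fun i hi => by
    rw [← hx, expField_expVec_eq_zero α γ (by omega)]
  have x_heis : ∀ (h : Car ℓ) (n i : ℤ), 0 < n →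
      heis h n (x i) = carForm h (latToCar α) • x (i - n) := by
    intro h n i hn
    rw [← hx, ← hx, heis_expField, heis_expVec h hn, map_zero, zero_add,
      show -1 - latForm α γ - i + n = -1 - latForm α γ - (i - n) by ring]
  simp only [hx]
  induction j using Nat.strong_induction_on with
  | _ j ih =>
  rw [← sub_eq_zero]
  refine eq_zero_of_heis (fun h k => ?_) fun δ => ?_
  · rw [map_sub, map_smul, map_sum, x_heis h _ _ (by omega)]
    simp only [heis_comm h, x_heis h _ _ (show (0 : ℤ) < (k + 1 : ℕ) by omega), map_smul,
      Finset.sum_add_distrib, ← Finset.smul_sum]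
    -- The summand `i = j - (k + 1)` contributes the scalar of the Heisenberg commutator, the others
    -- form the right-hand side of the equation for `j - (k + 1)`.
    by_cases hk : k + 1 ≤ j
    · obtain ⟨j', rfl⟩ := Nat.exists_eq_add_of_le hk
      rw [Finset.sum_range_add, Finset.sum_eq_zero (s := Finset.range (k + 1)), zero_add,
        Finset.sum_congr rfl (g := fun i : ℕ => heis (latToCar α) ((i : ℤ) - j') (x i)), ← ih j'
        (by omega), Finset.sum_eq_single j']
      · rw [if_pos (by push_cast; ring), show (((k + 1 + j' : ℕ) : ℤ) - (k + 1 : ℕ)) = j' by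
          push_cast; ring, smul_smul, smul_smul, ← add_smul, ← sub_smul]
        convert zero_smul ℂ _
        push_cast
        ring
      · intro b _ hb
        rw [if_neg (by omega), zero_smul]
      · intro h
        simp at h
      · intro i _
        congr 2 <;> push_cast <;> ring
      · intro i hi
        rw [Finset.mem_range] at hi
        rw [x_neg _ (by omega), map_zero]
    · rw [x_neg _ (by omega), Finset.sum_eq_zero, Finset.sum_eq_zero]
      · simp
      · intro i hi
        rw [Finset.mem_range] at hi
        rw [if_neg (by omega), zero_smul]
      · intro i hi
        rw [Finset.mem_range] at hi
        rw [x_neg _ (by omega), map_zero]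
  · have e1 : MvPolynomial.coeff 0
        ((∑ i ∈ Finset.range j, heis (latToCar α) ((i : ℤ) - j) (x i)) δ) = 0 := by
      rw [Finsupp.finsetSum_apply, MvPolynomial.coeff_sum]
      refine Finset.sum_eq_zero fun i hi => ?_
      rw [Finset.mem_range] at hi
      exact coeff_zero_heis_neg _ (by omega) _ _
    rw [Finsupp.sub_apply, MvPolynomial.coeff_sub, e1, sub_zero, Finsupp.smul_apply,
      MvPolynomial.coeff_smul]
    rcases Nat.eq_zero_or_pos j with rfl | hj
    · simp
    · rw [← hx, coeff_eq_zero_of_mem_gr (expField_mem_gr α _ (expVec_mem_gr γ))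
        (Or.inr (by simp [wt]; omega)), smul_zero]

/-- The coefficient of `e^{α+β+γ}` in `E^α_(p) E^β_(q) e^γ`, where `q = -1 - (β | γ) - j` and `p` is
the only index for which it can be nonzero. -/
noncomputable def prodCoeff (α β γ : Lat ℓ) (j : ℤ) : ℂ :=
  MvPolynomial.coeff 0 ((expField α).1 (-1 - latForm α γ - latForm α β + j)
    ((expField β).1 (-1 - latForm β γ - j) (expVec γ)) (α + β + γ))

theorem prodCoeff_of_neg (α β γ : Lat ℓ) {j : ℤ} (hj : j < 0) : prodCoeff α β γ j = 0 := by
  rw [prodCoeff, expField_expVec_eq_zero β γ (by omega)]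
  simp

theorem prodCoeff_zero (α β γ : Lat ℓ) :
    prodCoeff α β γ 0 = (((eps α β * eps α γ * eps β γ : ℤˣ) : ℤ) : ℂ) := by
  rw [prodCoeff, sub_zero, expField_expVec, map_smul]
  have e : -1 - latForm α γ - latForm α β + 0 = -1 - latForm α (β + γ) := by
    rw [latForm_add_right]
    ring
  rw [e, expField_expVec, add_assoc, eps_add_right, expVec, Finsupp.smul_apply, Finsupp.smul_apply,
    Finsupp.single_eq_same, MvPolynomial.coeff_smul, MvPolynomial.coeff_smul,
    MvPolynomial.coeff_zero_one]
  push_cast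
  simp only [smul_eq_mul]
  ring

/-- Replace `E^β_(q) e^γ` by `smul_expField_expVec` and move the creation operators to the left,
where the constant term kills them. -/
theorem natCast_mul_prodCoeff (α β γ : Lat ℓ) (j : ℕ) :
    (j : ℂ) * prodCoeff α β γ j =
      -(latForm α β : ℂ) * ∑ i ∈ Finset.range j, prodCoeff α β γ i := by
  rw [prodCoeff, ← smul_eq_mul, ← MvPolynomial.coeff_smul, ← Finsupp.smul_apply, ← map_smul,
    smul_expField_expVec, map_sum, Finsupp.finsetSum_apply, MvPolynomial.coeff_sum,
    Finset.mul_sum]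
  refine Finset.sum_congr rfl fun i hi => ?_
  rw [Finset.mem_range] at hi
  rw [← sub_eq_iff_eq_add.2 (heis_expField (latToCar β) α ((i : ℤ) - j) _ _), Finsupp.sub_apply,
    MvPolynomial.coeff_sub, coeff_zero_heis_neg _ (by omega), zero_sub, Finsupp.smul_apply,
    MvPolynomial.coeff_smul, carForm_latToCar, latForm_comm β α, smul_eq_mul, neg_mul, prodCoeff,
    show -1 - latForm α γ - latForm α β + (j : ℤ) + ((i : ℤ) - j) =
      -1 - latForm α γ - latForm α β + i by ring]

/-- The recursion for the coefficients of `(z - w) ^ (α | β)`, expanded for `|z| > |w|`. -/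
theorem prodCoeff_succ (α β γ : Lat ℓ) (j : ℕ) :
    ((j : ℂ) + 1) * prodCoeff α β γ ((j + 1 : ℕ) : ℤ) =
      ((j : ℂ) - latForm α β) * prodCoeff α β γ j := by
  have h1 := natCast_mul_prodCoeff α β γ (j + 1)
  rw [Finset.sum_range_succ, mul_add, ← natCast_mul_prodCoeff] at h1
  push_cast at h1 ⊢
  rw [h1]
  ring

theorem prodCoeff_of_form_neg_one {α β : Lat ℓ} (γ : Lat ℓ) (h : latForm α β = -1) (j : ℕ) :
    prodCoeff α β γ j = prodCoeff α β γ 0 := by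
  induction j with
  | zero => rfl
  | succ j ih =>
    have h1 := prodCoeff_succ α β γ j
    rw [← ih]
    rw [h] at h1
    push_cast at h1 ⊢
    rw [sub_neg_eq_add] at h1
    exact mul_left_cancel₀ (Nat.cast_add_one_ne_zero j) h1

theorem prodCoeff_of_form_lt {α β : Lat ℓ} (γ : Lat ℓ) {r : ℕ} (h : latForm α β = r) {j : ℕ}
    (hj : r < j) : prodCoeff α β γ j = 0 := by
  induction j, hj using Nat.le_induction with
  | base =>
    have h1 := prodCoeff_succ α β γ r
    rw [h, Int.cast_natCast, sub_self, zero_mul] at h1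
    exact (mul_eq_zero.1 h1).resolve_left (Nat.cast_add_one_ne_zero r)
  | succ j _ ih =>
    have h1 := prodCoeff_succ α β γ j
    rw [ih, mul_zero] at h1
    exact (mul_eq_zero.1 h1).resolve_left (Nat.cast_add_one_ne_zero j)

theorem prodCoeff_one {α β : Lat ℓ} (γ : Lat ℓ) (h : latForm α β = 1) :
    prodCoeff α β γ 1 = -prodCoeff α β γ 0 := by
  have h1 := prodCoeff_succ α β γ 0
  rw [h] at h1
  simpa using h1

theorem coeff_expField_expField {α β γ : Lat ℓ} {p q : ℤ}
    (h : p + q = -2 - latForm α β - latForm α γ - latForm β γ) :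
    MvPolynomial.coeff 0 ((expField α).1 p ((expField β).1 q (expVec γ)) (α + β + γ)) =
      prodCoeff α β γ (-1 - latForm β γ - q) := by
  rw [prodCoeff, show -1 - latForm β γ - (-1 - latForm β γ - q) = q by ring,
    show -1 - latForm α γ - latForm α β + (-1 - latForm β γ - q) = p by omega]

theorem expField_expField_mem_gr (α β γ : Lat ℓ) (p q : ℤ) :
    (expField α).1 p ((expField β).1 q (expVec γ)) ∈
      gr (α + β + γ) (-(p + q + 2 + latForm α β + latForm α γ + latForm β γ)) := by
  have := expField_mem_gr α p (expField_mem_gr β q (expVec_mem_gr γ))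
  rw [latForm_add_right, ← add_assoc] at this
  convert this using 2
  ring

/-- A family of operators with the commutation relations of `E^α_(p) E^β_(q)` with the Heisenberg
algebra vanishes if it kills each `e^γ` for large `p + q` and the images of all `e^γ` have no
constant terms. -/
theorem eq_zero_of_intertwining {α β : Lat ℓ} {C : ℤ → ℤ → Module.End ℂ (VQ ℓ)}
    (h1 : ∀ (h : Car ℓ) (n p q : ℤ) (u : VQ ℓ), heis h n (C p q u) = C p q (heis h n u) +
      carForm h (latToCar α) • C (p + n) q u + carForm h (latToCar β) • C p (q + n) u)
    (h2 : ∀ γ, ∃ K : ℤ, ∀ p q, K ≤ p + q → C p q (expVec γ) = 0)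
    (h3 : ∀ γ δ p q, MvPolynomial.coeff 0 (C p q (expVec γ) δ) = 0) (p q : ℤ) : C p q = 0 := by
  -- On `e^γ`, by descending induction on `p + q`, which the positive modes increase.
  have h4 : ∀ γ p q, C p q (expVec γ) = 0 := by
    intro γ
    obtain ⟨K, hK⟩ := h2 γ
    have : ∀ N : ℕ, ∀ p q, K ≤ p + q + N → C p q (expVec γ) = 0 := by
      intro N
      induction N with
      | zero => exact fun p q h => hK p q (by omega)
      | succ N ih =>
        intro p q h
        refine eq_zero_of_heis (fun h k => ?_) fun δ => h3 γ δ p q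
        rw [h1, heis_expVec h (by omega), ih (p + (k + 1 : ℕ)) q (by omega),
          ih p (q + (k + 1 : ℕ)) (by omega)]
        simp
    exact fun p q => this (K - (p + q)).toNat p q (by omega)
  have h5 : (⨅ p, ⨅ q, LinearMap.ker (C p q)) = ⊤ := by
    refine eq_top_of_heis _ (fun γ => ?_) fun h k u hu => ?_
    · simp only [Submodule.mem_iInf, LinearMap.mem_ker]
      exact h4 γ
    · simp only [Submodule.mem_iInf, LinearMap.mem_ker] at hu ⊢
      intro p q
      have := h1 h (Int.negSucc k) p q u
      simpa [hu] using this.symm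
  refine LinearMap.ext fun u => ?_
  have : u ∈ (⨅ p, ⨅ q, LinearMap.ker (C p q)) := h5 ▸ Submodule.mem_top
  simp only [Submodule.mem_iInf, LinearMap.mem_ker] at this
  exact this p q

/-- A commutation relation for the modes of `E^α(z)` and `E^β(z)` holds as soon as the matrix
coefficients between the `e^γ` and the `e^{α+β+γ}` agree. By homogeneity only the indices with
`p + q = -2 - (α | β) - (α | γ) - (β | γ)` matter. The term with `E^{α+β}` has the right degree only
if `(α | β) = -1`. -/
theorem expField_commutator_aux {α β : Lat ℓ} {s : ℂ} (hs : s = 0 ∨ latForm α β = -1)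
    (hc : ∀ γ (j : ℤ), prodCoeff α β γ j - prodCoeff β α γ (latForm α β - j) =
      s * (((eps α γ * eps β γ : ℤˣ) : ℤ) : ℂ)) (p q : ℤ) :
    (expField α).1 p * (expField β).1 q =
      (expField β).1 q * (expField α).1 p + s • (expField (α + β)).1 (p + q) := by
  have hg : ∀ γ p q, s • (expField (α + β)).1 (p + q) (expVec γ) ∈
      gr (α + β + γ) (-(p + q + 2 + latForm α β + latForm α γ + latForm β γ)) := by
    intro γ p q
    rcases hs with rfl | hs
    · rw [zero_smul]
      exact Submodule.zero_mem _
    · refine Submodule.smul_mem _ _ ?_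
      have := expField_mem_gr (α + β) (p + q) (expVec_mem_gr γ)
      rw [latForm_add_left] at this
      convert this using 2
      rw [hs]
      ring
  set C : ℤ → ℤ → Module.End ℂ (VQ ℓ) := fun p q => (expField α).1 p * (expField β).1 q -
    (expField β).1 q * (expField α).1 p - s • (expField (α + β)).1 (p + q) with hC
  have hCg : ∀ γ p q, C p q (expVec γ) ∈
      gr (α + β + γ) (-(p + q + 2 + latForm α β + latForm α γ + latForm β γ)) := by
    intro γ p q
    refine Submodule.sub_mem _ (Submodule.sub_mem _ (expField_expField_mem_gr α β γ p q) ?_)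
      (hg γ p q)
    have := expField_expField_mem_gr β α γ q p
    rw [latForm_comm β α, add_comm β α] at this
    rwa [show p + q + 2 + latForm α β + latForm α γ + latForm β γ =
      q + p + 2 + latForm α β + latForm β γ + latForm α γ by ring]
  have : C p q = 0 := by
    refine eq_zero_of_intertwining (α := α) (β := β) ?_ ?_ ?_ p q
    · intro h n p q u
      simp only [hC, LinearMap.sub_apply, Module.End.mul_apply, LinearMap.smul_apply, map_sub,
        map_add, map_smul, heis_expField h]
      have e : carForm h (latToCar (α + β)) =
          carForm h (latToCar α) + carForm h (latToCar β) := by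
        simp [carForm, latToCar, mul_add, Finset.sum_add_distrib]
      rw [e, add_right_comm p n q, ← add_assoc p q n]
      module
    · intro γ
      exact ⟨-1 - latForm α β - latForm α γ - latForm β γ, fun p q h =>
        gr_neg (by omega) (hCg γ p q)⟩
    · intro γ δ p q
      by_cases hδ : α + β + γ = δ ∧ p + q = -2 - latForm α β - latForm α γ - latForm β γ
      · obtain ⟨rfl, hpq⟩ := hδ
        have e1 := coeff_expField_expField hpq
        have e2 := coeff_expField_expField (α := β) (β := α) (γ := γ) (p := q) (q := p)
          (by rw [latForm_comm β α]; omega)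
        have e3 := hc γ (-1 - latForm β γ - q)
        rw [show latForm α β - (-1 - latForm β γ - q) = -1 - latForm α γ - p by omega] at e3
        rw [add_comm β α] at e2
        simp only [hC, LinearMap.sub_apply, Module.End.mul_apply, LinearMap.smul_apply,
          Finsupp.sub_apply, MvPolynomial.coeff_sub, Finsupp.smul_apply, MvPolynomial.coeff_smul]
        rw [e1, e2, e3]
        rcases hs with rfl | hs
        · simp
        · rw [show p + q = -1 - latForm (α + β) γ by rw [latForm_add_left]; omega,
            expField_expVec, Finsupp.smul_apply, MvPolynomial.coeff_smul, expVec,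
            Finsupp.single_eq_same, eps_add_left, MvPolynomial.coeff_zero_one]
          simp
      · refine coeff_eq_zero_of_mem_gr (hCg γ p q) ?_
        by_cases h : α + β + γ = δ
        · refine Or.inr fun h' => hδ ⟨h, ?_⟩
          simp [wt] at h'
          omega
        · exact Or.inl h
  refine LinearMap.ext fun u => ?_
  have e := LinearMap.congr_fun this u
  simp only [hC, LinearMap.sub_apply, LinearMap.zero_apply] at e
  exact sub_eq_iff_eq_add'.1 (sub_eq_zero.1 e)

/-- `[E^α_(p), E^β_(q)] = ε(α, β) E^{α+β}_(p+q)` if `(α | β) = -1`. -/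
theorem expField_commutator {α β : Lat ℓ} (h : latForm α β = -1)
    (hε : eps β α = -eps α β) (p q : ℤ) :
    (expField α).1 p * (expField β).1 q = (expField β).1 q * (expField α).1 p +
      (((eps α β : ℤˣ) : ℤ) : ℂ) • (expField (α + β)).1 (p + q) := by
  refine expField_commutator_aux (Or.inr h) (fun γ j => ?_) p q
  have h' : latForm β α = -1 := by rw [latForm_comm, h]
  rw [h]
  -- Exactly one of the two products contributes, according to the sign of `j`: this is the
  -- difference of the two expansions of `(z - w)⁻¹`.
  rcases lt_or_ge j 0 with hj | hj
  · obtain ⟨i, hi⟩ := Int.eq_ofNat_of_zero_le (show 0 ≤ -1 - j by omega)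
    rw [prodCoeff_of_neg _ _ _ hj, hi]
    rw [prodCoeff_of_form_neg_one γ h', prodCoeff_zero, hε]
    push_cast
    ring
  · obtain ⟨i, rfl⟩ := Int.eq_ofNat_of_zero_le hj
    rw [prodCoeff_of_neg β α γ (by omega)]
    rw [prodCoeff_of_form_neg_one γ h, prodCoeff_zero]
    push_cast
    ring

/-- `E^α_(p)` and `E^β_(q)` commute if `(α | β)` is `0` or `1` and the cocycle has the sign that
belongs to it. -/
theorem expField_commute {α β : Lat ℓ}
    (h : latForm α β = 0 ∧ eps β α = eps α β ∨ latForm α β = 1 ∧ eps β α = -eps α β) (p q : ℤ) :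
    (expField α).1 p * (expField β).1 q = (expField β).1 q * (expField α).1 p := by
  have key := expField_commutator_aux (α := α) (β := β) (s := 0) (Or.inl rfl) ?_ p q
  · rwa [zero_smul, add_zero] at key
  intro γ j
  rw [zero_mul]
  have zero_of : ∀ {α β : Lat ℓ}, latForm α β = 0 ∨ latForm α β = 1 → ∀ j, latForm α β < j →
      prodCoeff α β γ j = 0 := by
    intro α β h j hj
    obtain ⟨r, hr⟩ := Int.eq_ofNat_of_zero_le (show 0 ≤ latForm α β by omega)
    obtain ⟨i, rfl⟩ := Int.eq_ofNat_of_zero_le (show 0 ≤ j by omega)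
    exact prodCoeff_of_form_lt γ hr (by omega)
  have c := latForm_comm β α
  rcases lt_or_ge j 0 with hj | hj
  · rw [prodCoeff_of_neg _ _ _ hj, zero_of (by omega) _ (by omega), sub_zero]
  rcases lt_or_ge (latForm α β) j with hj' | hj'
  · rw [zero_of (by omega) _ hj', prodCoeff_of_neg β α γ (by omega), sub_zero]
  rcases h with ⟨h, hε⟩ | ⟨h, hε⟩
  · obtain rfl : j = 0 := by omega
    rw [h, sub_zero, prodCoeff_zero, prodCoeff_zero, hε]
    push_cast
    ring
  · rw [h]
    obtain rfl | rfl : j = 0 ∨ j = 1 := by omega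
    · rw [sub_zero, prodCoeff_one γ (c.trans h), prodCoeff_zero, prodCoeff_zero, hε]
      push_cast
      ring
    · rw [sub_self, prodCoeff_one γ h, prodCoeff_zero, prodCoeff_zero, hε]
      push_cast
      ring

/-! ### The modes of the generators of the affine Lie algebra -/

theorem mode_expVec (α : Lat ℓ) (m : ℤ) : mode (expVec α) m = (expField α).1 m := by
  have e : (1 : SymNeg ℓ) = MvPolynomial.basisMonomials (Fin ℓ × ℕ) ℂ 0 := by
    rw [MvPolynomial.coe_basisMonomials]
    rfl
  rw [mode, stateField, expVec, Finsupp.lsum_single, e, Module.Basis.constr_basis]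
  simp

theorem eps_zero_left (β : Lat ℓ) : eps 0 β = 1 := by
  simp [eps]

/-- `E^0(z)` is the identity. -/
theorem expField_zero (m : ℤ) :
    (expField (0 : Lat ℓ)).1 m = if m = -1 then 1 else 0 := by
  have f0 : ∀ γ : Lat ℓ, latForm 0 γ = 0 := fun γ => by simp [latForm]
  have e0 : ∀ γ : Lat ℓ, (expField (0 : Lat ℓ)).1 (-1) (expVec γ) = expVec γ := by
    intro γ
    have := expField_expVec 0 γ
    rw [f0, sub_zero, eps_zero_left] at this
    simpa using this
  set C : ℤ → ℤ → Module.End ℂ (VQ ℓ) := fun p q =>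
    (expField (0 : Lat ℓ)).1 (p + q) - if p + q = -1 then 1 else 0 with hC
  have h0 : C m 0 = 0 := by
    have hm : ∀ p q (γ : Lat ℓ), p + q = -1 → C p q (expVec γ) = 0 := by
      intro p q γ h
      simp only [hC, h, if_true]
      rw [LinearMap.sub_apply, e0]
      simp
    have hm' : ∀ p q (γ : Lat ℓ), p + q ≠ -1 → C p q (expVec γ) ∈ gr γ (-(p + q + 1)) := by
      intro p q γ h
      simp only [hC, if_neg h, LinearMap.sub_apply, LinearMap.zero_apply, sub_zero]
      have := expField_mem_gr 0 (p + q) (expVec_mem_gr γ)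
      rwa [f0, add_zero, zero_add, zero_sub] at this
    refine eq_zero_of_intertwining (α := 0) (β := 0) ?_ ?_ ?_ m 0
    · intro h n p q u
      have e : carForm h (latToCar (0 : Lat ℓ)) = 0 := by simp [carForm, latToCar]
      simp only [hC, LinearMap.sub_apply, map_sub, heis_expField h, e, zero_smul, add_zero]
      congr 1
      split_ifs <;> simp
    · intro γ
      refine ⟨0, fun p q h => gr_neg (by omega) (hm' p q γ (by omega))⟩
    · intro γ δ p q
      by_cases h : p + q = -1
      · rw [hm p q γ h]
        simp
      · exact coeff_eq_zero_of_mem_gr (hm' p q γ h) (Or.inr (by simp [wt]; omega))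
  simp only [hC, add_zero] at h0
  exact sub_eq_zero.1 h0

theorem mode_single_X (i : Fin ℓ) (m : ℤ) :
    mode (Finsupp.single 0 (MvPolynomial.X (i, 0))) m = heis (latToCar (latV i)) m := by
  have e : (MvPolynomial.X (i, 0) : SymNeg ℓ) =
      MvPolynomial.basisMonomials (Fin ℓ × ℕ) ℂ (Finsupp.single (i, 0) 1) := by
    rw [MvPolynomial.coe_basisMonomials]
    rfl
  rw [mode, stateField, Finsupp.lsum_single, e, Module.Basis.constr_basis,
    Finsupp.toMultiset_single, one_nsmul, Multiset.toList_singleton]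
  simp only [List.foldr_cons, List.foldr_nil, Nat.factorial_zero, Nat.cast_one, inv_one, one_smul,
    Function.iterate_zero, id_eq]
  refine LinearMap.ext fun u => ?_
  change ∑ᶠ j, normalOrderTerm _ _ m j u = _
  rw [finsum_eq_single _ m]
  · rw [normalOrderTerm, show m - 1 - m = -1 by ring, expField_zero, if_pos rfl]
    split_ifs <;> rfl
  · intro j hj
    rw [normalOrderTerm, expField_zero, if_neg (show m - 1 - j ≠ -1 by omega)]
    simp

theorem carVec_eq_sum (h : Car ℓ) :
    carVec h = ∑ i, h i • (Finsupp.single 0 (MvPolynomial.X (i, 0)) : VQ ℓ) := by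
  rw [carVec, Finsupp.single_finsetSum]
  simp only [Finsupp.smul_single]

/-! ### Commutators with fields on a tensor product -/

section Box

variable {M N : Type*} [AddCommGroup M] [Module ℂ M] [AddCommGroup N] [Module ℂ N]

/-- The field with the modes `A_(p+k)`, that is `z ^ k A(z)`. -/
def shiftField (A : FieldSpace M) (k : ℤ) : FieldSpace M :=
  ⟨fun p => A.1 (p + k), fun u => by
    obtain ⟨K, hK⟩ := A.2 u
    exact ⟨K - k, fun n hn => hK _ (by omega)⟩⟩

theorem boxField_shift_right (A : FieldSpace M) (B : FieldSpace N) (k n : ℤ) :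
    (boxField A (shiftField B k)).1 n = (boxField A B).1 (n + k) := by
  refine LinearMap.ext fun u => ?_
  rw [boxField_apply, boxField_apply]
  refine finsum_congr fun p => ?_
  rw [show n + k - 1 - p = n - 1 - p + k by ring]
  rfl

theorem boxField_shift_left (A : FieldSpace M) (B : FieldSpace N) (k n : ℤ) :
    (boxField (shiftField A k) B).1 n = (boxField A B).1 (n + k) := by
  refine LinearMap.ext fun u => ?_
  rw [boxField_apply, boxField_apply]
  conv_rhs => rw [← finsum_comp_equiv (Equiv.addRight k)]
  refine finsum_congr fun p => ?_
  rw [Equiv.coe_addRight, show n + k - 1 - (p + k) = n - 1 - p by ring]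
  rfl

theorem boxField_smul_left (c : ℂ) (A : FieldSpace M) (B : FieldSpace N) (n : ℤ) :
    (boxField (c • A) B).1 n = c • (boxField A B).1 n :=
  congrArg (fun F : FieldSpace (M ⊗[ℂ] N) => F.1 n) (LinearMap.map_smul₂ (boxFieldBilin M N) c A B)

theorem boxField_smul_right (c : ℂ) (A : FieldSpace M) (B : FieldSpace N) (n : ℤ) :
    (boxField A (c • B)).1 n = c • (boxField A B).1 n :=
  congrArg (fun F : FieldSpace (M ⊗[ℂ] N) => F.1 n) (map_smul (boxFieldBilin M N A) c B)

theorem boxField_zero_left (B : FieldSpace N) (n : ℤ) :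
    (boxField (0 : FieldSpace M) B).1 n = 0 :=
  congrArg (fun F : FieldSpace (M ⊗[ℂ] N) => F.1 n) (LinearMap.map_zero₂ (boxFieldBilin M N) B)

theorem boxField_zero_right (A : FieldSpace M) (n : ℤ) :
    (boxField A (0 : FieldSpace N)).1 n = 0 :=
  congrArg (fun F : FieldSpace (M ⊗[ℂ] N) => F.1 n) (map_zero (boxFieldBilin M N A))

/-- The operator `X ⊗ 1 + 1 ⊗ X`. -/
noncomputable def diag (X : Module.End ℂ M) : Module.End ℂ (M ⊗[ℂ] M) :=
  TensorProduct.map X 1 + TensorProduct.map 1 X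

/-- If the commutators of `X` with `A(z)` and `B(z)` are `A'(z)` and `B'(z)`, the commutator of
`X ⊗ 1 + 1 ⊗ X` with `A(z) ⊠ B(z)` is `A'(z) ⊠ B(z) + A(z) ⊠ B'(z)`. -/
theorem diag_boxField {X : Module.End ℂ M} {A A' B B' : FieldSpace M}
    (hA : ∀ p, X * A.1 p = A.1 p * X + A'.1 p) (hB : ∀ p, X * B.1 p = B.1 p * X + B'.1 p) (n : ℤ) :
    diag X * (boxField A B).1 n =
      (boxField A B).1 n * diag X + ((boxField A' B).1 n + (boxField A B').1 n) := by
  refine LinearMap.ext fun u => ?_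
  simp only [Module.End.mul_apply, LinearMap.add_apply, boxField_apply]
  rw [map_finsum _ (boxTerm_finite A B n u), ← finsum_add_distrib (boxTerm_finite A' B n u)
    (boxTerm_finite A B' n u), ← finsum_add_distrib (boxTerm_finite A B n (diag X u))]
  · refine finsum_congr fun p => ?_
    induction u using TensorProduct.induction_on with
    | zero => simp
    | tmul x y =>
      have e1 := LinearMap.congr_fun (hA p) x
      have e2 := LinearMap.congr_fun (hB (n - 1 - p)) y
      simp only [Module.End.mul_apply, LinearMap.add_apply] at e1 e2
      simp only [diag, LinearMap.add_apply, TensorProduct.map_tmul, Module.End.one_apply, map_add,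
        e1, e2, TensorProduct.add_tmul, TensorProduct.tmul_add]
      abel
    | add u v hu hv =>
      simp only [map_add, hu, hv]
      abel
  · refine ((boxTerm_finite A' B n u).union (boxTerm_finite A B' n u)).subset ?_
    exact Function.support_add _ _

theorem diag_pow_tmul (X : Module.End ℂ M) (n : ℕ) (x y : M) :
    (diag X ^ n) (x ⊗ₜ y) = ∑ p ∈ Finset.HasAntidiagonal.antidiagonal n,
      (n.choose p.1 : ℂ) • ((X ^ p.1) x ⊗ₜ[ℂ] (X ^ p.2) y) := by
  have hc : Commute (TensorProduct.map X (1 : Module.End ℂ M))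
      (TensorProduct.map (1 : Module.End ℂ M) X) := by
    refine TensorProduct.ext' fun x y => ?_
    simp
  rw [diag, hc.add_pow', LinearMap.sum_apply]
  refine Finset.sum_congr rfl fun p _ => ?_
  rw [TensorProduct.map_pow, TensorProduct.map_pow, one_pow, one_pow, LinearMap.smul_apply,
    Module.End.mul_apply, TensorProduct.map_tmul, TensorProduct.map_tmul, Nat.cast_smul_eq_nsmul]
  rfl

end Box

/-! ### The operators `Ω_(m)` -/

theorem OmMode_eq_sum (m : ℤ) : OmMode ℓ m =
    ∑ k : Fin ℓ, (boxField (expField (latV k)) (expField (-latV k))).1 m := by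
  have e : ∀ α : Lat ℓ, stateField ℓ (expVec α) = expField α := fun α =>
    Subtype.ext (funext fun m => mode_expVec α m)
  rw [OmMode, Om, map_sum, Submodule.coe_sum, Finset.sum_apply]
  refine Finset.sum_congr rfl fun k _ => ?_
  rw [stateField₂, TensorProduct.lift.tmul, LinearMap.compl₁₂_apply, e, e]
  rfl

/-- In `E^{v_k}_(p) |0⟩ ⊠ E^{-v_k}_(q) |0⟩` with `p + q = m - 1 ≥ -1` one index is nonnegative. -/
theorem OmMode_vac {m : ℤ} (hm : 0 ≤ m) : OmMode ℓ m (vac ℓ ⊗ₜ vac ℓ) = 0 := by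
  rw [OmMode_eq_sum, LinearMap.sum_apply]
  refine Finset.sum_eq_zero fun k _ => ?_
  rw [boxField_apply]
  refine finsum_eq_zero_of_forall_eq_zero fun p => ?_
  rw [TensorProduct.map_tmul]
  have f0 : ∀ α : Lat ℓ, latForm α 0 = 0 := fun α => by simp [latForm]
  have h : ∀ (α : Lat ℓ) {p : ℤ}, 0 ≤ p → (expField α).1 p (vac ℓ) = 0 := fun α p hp =>
    expField_expVec_eq_zero α 0 (by rw [f0]; omega)
  rcases lt_or_ge p 0 with hp | hp
  · rw [h (-latV k) (by omega), TensorProduct.tmul_zero]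
  · rw [h _ hp, TensorProduct.zero_tmul]

theorem diag_heis_OmMode (h : Car ℓ) (n m : ℤ) :
    diag (heis h n) * OmMode ℓ m = OmMode ℓ m * diag (heis h n) := by
  rw [OmMode_eq_sum, Finset.mul_sum, Finset.sum_mul]
  refine Finset.sum_congr rfl fun k _ => ?_
  have key : ∀ (α : Lat ℓ) (p : ℤ), heis h n * (expField α).1 p = (expField α).1 p * heis h n +
      (carForm h (latToCar α) • shiftField (expField α) n).1 p := fun α p =>
    LinearMap.ext fun u => heis_expField h α n p u
  rw [diag_boxField (key _) (key _), boxField_smul_left, boxField_smul_right, boxField_shift_left,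
    boxField_shift_right, ← add_smul]
  have e : carForm h (latToCar (latV k)) + carForm h (latToCar (-latV k)) = 0 := by
    simp [carForm, latToCar]
  rw [e, zero_smul, add_zero]

theorem latForm_latV (i j : Fin ℓ) : latForm (latV i) (latV j) = if i = j then 1 else 0 := by
  simp [latForm, latV, Pi.single_apply, eq_comm]

theorem latForm_neg_right (α β : Lat ℓ) : latForm α (-β) = -latForm α β := by
  simp [latForm]

theorem latForm_sub_left (α α' β : Lat ℓ) :
    latForm (α - α') β = latForm α β - latForm α' β := by
  simp [latForm, sub_mul]

theorem eps_neg_right (α β : Lat ℓ) : eps α (-β) = eps α β := by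
  simp [eps]

theorem eps_neg_left (α β : Lat ℓ) : eps (-α) β = eps α β := by
  simp [eps]

theorem eps_latV (i j : Fin ℓ) : eps (latV i) (latV j) = epsSign i j := by
  rw [eps, Finset.prod_eq_single i, Finset.prod_eq_single j]
  · simp [latV]
  · intro b _ hb
    simp [latV, hb]
  · simp
  · intro b _ hb
    simp [latV, hb]
  · simp

theorem epsSign_swap {i j : Fin ℓ} (h : i ≠ j) : epsSign j i = -epsSign i j := by
  rcases lt_or_gt_of_ne h with h | h <;> simp [epsSign, h, h.not_gt]

theorem epsSign_self (i : Fin ℓ) : epsSign i i = -1 := by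
  simp [epsSign]

theorem eps_root_left (k l j : Fin ℓ) :
    eps (latV k - latV l) (latV j) = epsSign k j * epsSign l j := by
  rw [sub_eq_add_neg, eps_add_left, eps_neg_left, eps_latV, eps_latV]

theorem eps_root_right (k l j : Fin ℓ) :
    eps (latV j) (latV k - latV l) = epsSign j k * epsSign j l := by
  rw [sub_eq_add_neg, eps_add_right, eps_neg_right, eps_latV, eps_latV]

/-- The root vectors commute with the `E^{v_j}`, except for `j = l`. -/
theorem expField_root_latV {k l : Fin ℓ} (hkl : k ≠ l) (j : Fin ℓ) (n p : ℤ) :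
    (expField (latV k - latV l)).1 n * (expField (latV j)).1 p =
      (expField (latV j)).1 p * (expField (latV k - latV l)).1 n +
      (if j = l then (-((epsSign k l : ℤˣ) : ℤ) : ℂ) • shiftField (expField (latV k)) n
        else 0).1 p := by
  have hf : latForm (latV k - latV l) (latV j) =
      (if k = j then 1 else 0) - if l = j then 1 else 0 := by
    rw [latForm_sub_left, latForm_latV, latForm_latV]
  by_cases hl : j = l
  · subst hl
    rw [expField_commutator, if_pos rfl, eps_root_left, epsSign_self, sub_add_cancel, add_comm n p]
    · congr 2
      simp
    · rw [hf, if_neg hkl, if_pos rfl, zero_sub]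
    · rw [eps_root_left, eps_root_right, epsSign_swap hkl]
      simp
  · rw [if_neg hl, expField_commute, ZeroMemClass.coe_zero, Pi.zero_apply, add_zero]
    by_cases hk : j = k
    · subst hk
      refine Or.inr ⟨by rw [hf, if_pos rfl, if_neg (Ne.symm hl), sub_zero], ?_⟩
      rw [eps_root_left, eps_root_right, epsSign_swap hkl]
      simp
    · refine Or.inl ⟨by rw [hf, if_neg (Ne.symm hk), if_neg (Ne.symm hl), sub_zero], ?_⟩
      rw [eps_root_left, eps_root_right, epsSign_swap hk, epsSign_swap hl]
      simp

/-- The root vectors commute with the `E^{-v_j}`, except for `j = k`. -/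
theorem expField_root_neg_latV {k l : Fin ℓ} (hkl : k ≠ l) (j : Fin ℓ) (n p : ℤ) :
    (expField (latV k - latV l)).1 n * (expField (-latV j)).1 p =
      (expField (-latV j)).1 p * (expField (latV k - latV l)).1 n +
      (if j = k then (((epsSign k l : ℤˣ) : ℤ) : ℂ) • shiftField (expField (-latV l)) n
        else 0).1 p := by
  have hf : latForm (latV k - latV l) (-latV j) =
      (if l = j then 1 else 0) - if k = j then 1 else 0 := by
    rw [latForm_neg_right, latForm_sub_left, latForm_latV, latForm_latV, neg_sub]
  by_cases hk : j = k
  · subst hk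
    rw [expField_commutator, if_pos rfl, eps_neg_right, eps_root_left, epsSign_self,
      show latV j - latV l + -latV j = -latV l by abel, add_comm n p, epsSign_swap hkl]
    · congr 2
      simp
    · rw [hf, if_neg (Ne.symm hkl), if_pos rfl, zero_sub]
    · rw [eps_neg_right, eps_neg_left, eps_root_left, eps_root_right, epsSign_swap hkl]
      simp
  · rw [if_neg hk, expField_commute, ZeroMemClass.coe_zero, Pi.zero_apply, add_zero]
    rw [eps_neg_right, eps_neg_left, eps_root_left, eps_root_right]
    by_cases hl : j = l
    · subst hl
      refine Or.inr ⟨by rw [hf, if_pos rfl, if_neg (Ne.symm hk), sub_zero], ?_⟩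
      rw [epsSign_swap hkl]
      simp
    · refine Or.inl ⟨by rw [hf, if_neg (Ne.symm hk), if_neg (Ne.symm hl), sub_zero], ?_⟩
      rw [epsSign_swap hk, epsSign_swap hl]
      simp

/-- The terms in `E^{v_k}(z) ⊠ E^{-v_l}(z)` coming from `E^{v_l}(z) ⊠ E^{-v_l}(z)` and from
`E^{v_k}(z) ⊠ E^{-v_k}(z)` cancel. -/
theorem diag_root_OmMode {k l : Fin ℓ} (hkl : k ≠ l) (n m : ℤ) :
    diag ((expField (latV k - latV l)).1 n) * OmMode ℓ m =
      OmMode ℓ m * diag ((expField (latV k - latV l)).1 n) := by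
  rw [OmMode_eq_sum, Finset.mul_sum, Finset.sum_mul]
  rw [Finset.sum_congr rfl fun j _ =>
    diag_boxField (expField_root_latV hkl j n) (expField_root_neg_latV hkl j n) m]
  rw [Finset.sum_add_distrib]
  refine (congrArg _ ?_).trans (add_zero _)
  rw [Finset.sum_add_distrib]
  rw [Finset.sum_eq_single l, Finset.sum_eq_single k, if_pos rfl, if_pos rfl, boxField_smul_left,
    boxField_smul_right, boxField_shift_left, boxField_shift_right, ← add_smul, neg_add_cancel,
    zero_smul]
  · intro j _ hj
    rw [if_neg hj, boxField_zero_right]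
  · simp
  · intro j _ hj
    rw [if_neg hj, boxField_zero_left]
  · simp

/-- The operators `X` for which `X ⊗ 1 + 1 ⊗ X` commutes with `Ω_(m)`. -/
noncomputable def omCentralizer (ℓ : ℕ) (m : ℤ) : Submodule ℂ (Module.End ℂ (VQ ℓ)) where
  carrier := {X | diag X * OmMode ℓ m = OmMode ℓ m * diag X}
  zero_mem' := by
    simp [diag]
  add_mem' := by
    intro X Y hX hY
    have e : diag (X + Y) = diag X + diag Y := by
      simp only [diag, TensorProduct.map_add_left, TensorProduct.map_add_right]
      abel
    simp only [Set.mem_ofPred_eq] at hX hY ⊢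
    rw [e, add_mul, mul_add, hX, hY]
  smul_mem' := by
    intro c X hX
    have e : diag (c • X) = c • diag X := by
      simp only [diag, TensorProduct.map_smul_left, TensorProduct.map_smul_right, smul_add]
    simp only [Set.mem_ofPred_eq] at hX ⊢
    rw [e, smul_mul_assoc, mul_smul_comm, hX]

theorem affineSpace_le_omCentralizer (m : ℤ) : affineSpace ℓ ≤ omCentralizer ℓ m := by
  have modeLin : ∀ n, ∃ f : VQ ℓ →ₗ[ℂ] Module.End ℂ (VQ ℓ), ∀ a, f a = mode a n := fun n =>
    ⟨(LinearMap.proj n ∘ₗ (FieldSpace (VQ ℓ)).subtype) ∘ₗ stateField ℓ, fun _ => rfl⟩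
  refine sup_le (Submodule.span_le.2 ?_) (Submodule.span_le.2 ?_)
  · rintro _ ⟨a, ha, n, rfl⟩
    obtain ⟨f, hf⟩ := modeLin n
    rw [SetLike.mem_coe, ← hf, ← Submodule.mem_comap]
    refine Submodule.span_le.2 ?_ ha
    rintro _ (⟨i, j, -, rfl⟩ | ⟨k, l, hkl, rfl⟩)
    · rw [SetLike.mem_coe, carVec_eq_sum]
      refine Submodule.sum_mem _ fun i _ => Submodule.smul_mem _ _ ?_
      rw [Submodule.mem_comap, hf, mode_single_X]
      exact diag_heis_OmMode _ _ _
    · refine Submodule.smul_mem _ _ ?_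
      rw [Submodule.mem_comap, hf, mode_expVec]
      exact diag_root_OmMode hkl _ _
  · rintro _ rfl
    have e : diag (1 : Module.End ℂ (VQ ℓ)) = 1 + 1 := by
      rw [diag, TensorProduct.map_one]
    change diag _ * _ = _ * diag _
    rw [e, add_mul, mul_add, one_mul, mul_one]

/-- The terms of the Cauchy product of `e^X |0⟩` with itself are killed by `Ω_(m)`. -/
theorem OmMode_cauchy {X : Module.End ℂ (VQ ℓ)} (hX : X ∈ affineSpace ℓ) {m : ℤ} (hm : 0 ≤ m)
    (n : ℕ) : ∑ p ∈ Finset.HasAntidiagonal.antidiagonal n, OmMode ℓ m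
      (((p.1.factorial : ℂ)⁻¹ • (X ^ p.1) (vac ℓ)) ⊗ₜ[ℂ]
        ((p.2.factorial : ℂ)⁻¹ • (X ^ p.2) (vac ℓ))) = 0 := by
  have hc : Commute (diag X) (OmMode ℓ m) := affineSpace_le_omCentralizer m hX
  have h1 : OmMode ℓ m ((diag X ^ n) (vac ℓ ⊗ₜ vac ℓ)) = 0 := by
    have := LinearMap.congr_fun (hc.pow_left n).eq (vac ℓ ⊗ₜ vac ℓ)
    rw [Module.End.mul_apply, Module.End.mul_apply, OmMode_vac hm, map_zero] at this
    exact this.symm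
  rw [diag_pow_tmul, map_sum] at h1
  have h2 := congrArg ((n.factorial : ℂ)⁻¹ • ·) h1
  simp only [Finset.smul_sum, smul_zero] at h2
  rw [← h2]
  refine Finset.sum_congr rfl fun p hp => ?_
  rw [Finset.HasAntidiagonal.mem_antidiagonal] at hp
  rw [TensorProduct.smul_tmul_smul, map_smul, map_smul, smul_smul]
  congr 1
  rw [← hp, Nat.cast_add_choose]
  have := Nat.cast_ne_zero (R := ℂ).2 (Nat.factorial_ne_zero (p.1 + p.2))
  have := Nat.cast_ne_zero (R := ℂ).2 (Nat.factorial_ne_zero p.1)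
  have := Nat.cast_ne_zero (R := ℂ).2 (Nat.factorial_ne_zero p.2)
  field_simp

/-! ### Cauchy products of conditionally convergent series -/

/-- A linear relation between the terms of Cauchy products of convergent series passes to the
products of the sums, even if neither the series nor their Cauchy products converge absolutely:
the relation holds for the power series with these coefficients inside the unit disc, and Abel's
limit theorem gives it at `1`. -/
theorem sum_mul_eq_zero_of_cauchy {ι : Type*} (F : Finset (ι × ι)) (c : ι × ι → ℂ) (f : ι → ℕ → ℂ)
    (l : ι → ℂ)
    (hf : ∀ i, Filter.Tendsto (fun N => ∑ n ∈ Finset.range N, f i n) Filter.atTop (nhds (l i)))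
    (h0 : ∀ n, ∑ i ∈ F, c i * ∑ p ∈ Finset.HasAntidiagonal.antidiagonal n,
      f i.1 p.1 * f i.2 p.2 = 0) :
    ∑ i ∈ F, c i * (l i.1 * l i.2) = 0 := by
  have abel : ∀ i, Filter.Tendsto (fun z => ∑' n, f i n * z ^ n)
      (Filter.map Complex.ofReal (nhdsWithin 1 (Set.Iio 1))) (nhds (l i)) := fun i =>
    Complex.tendsto_tsum_powerSeries_nhdsWithin_lt (hf i)
  have lim : Filter.Tendsto (fun z => ∑ i ∈ F, c i *
      ((∑' n, f i.1 n * z ^ n) * ∑' n, f i.2 n * z ^ n))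
      (Filter.map Complex.ofReal (nhdsWithin 1 (Set.Iio 1)))
      (nhds (∑ i ∈ F, c i * (l i.1 * l i.2))) :=
    tendsto_finsetSum _ fun i _ => ((abel i.1).mul (abel i.2)).const_mul _
  refine tendsto_nhds_unique (lim.congr' (f₂ := fun _ => 0) ?_) tendsto_const_nhds
  have ev : ∀ᶠ t : ℝ in nhdsWithin 1 (Set.Iio 1), t ∈ Set.Ioo (0 : ℝ) 1 :=
    Ioo_mem_nhdsLT zero_lt_one
  rw [Filter.EventuallyEq, Filter.eventually_map]
  filter_upwards [ev] with (t : ℝ) ht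
  set z : ℂ := Complex.ofReal t with hz
  have hz1 : ‖z‖ < 1 := by
    rw [hz, Complex.norm_real, Real.norm_of_nonneg ht.1.le]
    exact ht.2
  have summ : ∀ i, Summable fun n => ‖f i n * z ^ n‖ := fun i =>
    (summable_powerSeries_of_norm_lt_one (hf i).cauchySeq hz1).norm
  have prod : ∀ i : ι × ι, HasSum (fun n => ∑ p ∈ Finset.HasAntidiagonal.antidiagonal n,
      (f i.1 p.1 * z ^ p.1) * (f i.2 p.2 * z ^ p.2))
      ((∑' n, f i.1 n * z ^ n) * ∑' n, f i.2 n * z ^ n) := by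
    intro i
    rw [tsum_mul_tsum_eq_tsum_sum_antidiagonal_of_summable_norm (summ _) (summ _)]
    exact (summable_norm_sum_mul_antidiagonal_of_summable_norm (summ _) (summ _)).of_norm.hasSum
  have total := hasSum_sum fun i (_ : i ∈ F) => (prod i).mul_left (c i)
  refine total.unique ?_
  have e : ∀ n, ∑ i ∈ F, c i * ∑ p ∈ Finset.HasAntidiagonal.antidiagonal n,
      (f i.1 p.1 * z ^ p.1) * (f i.2 p.2 * z ^ p.2) = 0 := by
    intro n
    refine Eq.trans ?_ ((congrArg (z ^ n * ·) (h0 n)).trans (mul_zero _))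
    simp only [Finset.mul_sum]
    refine Finset.sum_congr rfl fun i _ => Finset.sum_congr rfl fun p hp => ?_
    rw [Finset.HasAntidiagonal.mem_antidiagonal] at hp
    rw [← hp, pow_add]
    ring
  simp only [e]
  exact hasSum_zero

/-! ### Coefficients of vectors in the tensor square -/

/-- The basis of `V_Q` formed by the `g ⊗ e^β` with `g` a monomial. -/
noncomputable def basisVQ (ℓ : ℕ) : Module.Basis (Σ _ : Lat ℓ, Fin ℓ × ℕ →₀ ℕ) ℂ (VQ ℓ) :=
  Finsupp.basis fun _ => MvPolynomial.basisMonomials (Fin ℓ × ℕ) ℂ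

theorem basisVQ_apply (i : Σ _ : Lat ℓ, Fin ℓ × ℕ →₀ ℕ) :
    basisVQ ℓ i = Finsupp.single i.1 (MvPolynomial.monomial i.2 1) := by
  rw [basisVQ, Finsupp.coe_basis, MvPolynomial.coe_basisMonomials]

theorem basisVQ_mem_gr (i : Σ _ : Lat ℓ, Fin ℓ × ℕ →₀ ℕ) : basisVQ ℓ i ∈ gr i.1 (wt i.2) := by
  rw [basisVQ_apply]
  exact monomial_mem_gr _ _

theorem finite_wt_le (N : ℤ) : {s : Fin ℓ × ℕ →₀ ℕ | wt s ≤ N}.Finite := by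
  refine (Set.finite_Iic (Finsupp.indicator (Finset.univ ×ˢ Finset.range N.toNat)
    fun _ _ => N.toNat)).subset fun s hs => ?_
  rw [Set.mem_ofPred_eq] at hs
  rw [Set.mem_Iic]
  intro p
  by_cases hp : s p = 0
  · rw [hp]
    exact Nat.zero_le _
  have h1 : (s p : ℤ) * ((p.2 : ℤ) + 1) ≤ N := le_trans
    (Finset.single_le_sum (f := fun p : Fin ℓ × ℕ => (s p : ℤ) * ((p.2 : ℤ) + 1))
      (fun p _ => by positivity) (Finsupp.mem_support_iff.2 hp)) hs
  have h2 : (1 : ℤ) ≤ s p := by omega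
  rw [Finsupp.indicator_of_mem]
  · have : (s p : ℤ) ≤ N := by nlinarith
    omega
  · have : (p.2 : ℤ) + 1 ≤ N := by nlinarith
    simp
    omega

/-- Each coefficient of `Ω_(m) (x ⊠ y)` involves only finitely many coefficients of `x` and `y`:
`Ω_(m)` is homogeneous for the total degree, and the homogeneous components are finite-dimensional
once the elements of the lattice are fixed. -/
theorem OmMode_coeff_finite (m : ℤ)
    (a : (Σ _ : Lat ℓ, Fin ℓ × ℕ →₀ ℕ) × (Σ _ : Lat ℓ, Fin ℓ × ℕ →₀ ℕ)) :
    {i : (Σ _ : Lat ℓ, Fin ℓ × ℕ →₀ ℕ) × (Σ _ : Lat ℓ, Fin ℓ × ℕ →₀ ℕ) |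
      ((basisVQ ℓ).tensorProduct (basisVQ ℓ)).repr
        (OmMode ℓ m (basisVQ ℓ i.1 ⊗ₜ basisVQ ℓ i.2)) a ≠ 0}.Finite := by
  obtain ⟨⟨γ, t⟩, γ', t'⟩ := a
  -- The total degree of the basis vectors that the `k`-th summand of `Ω_(m)` takes to the given
  -- degree.
  set N : Fin ℓ → ℤ := fun k => wt t + wt t' + m + 1 + latForm (latV k) (γ - latV k) +
    latForm (-latV k) (γ' + latV k) with hN
  have fin : (⋃ k : Fin ℓ, (Sigma.mk (β := fun _ : Lat ℓ => Fin ℓ × ℕ →₀ ℕ) (γ - latV k) ''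
      {s | wt s ≤ N k}) ×ˢ (Sigma.mk (β := fun _ : Lat ℓ => Fin ℓ × ℕ →₀ ℕ) (γ' + latV k) ''
      {s | wt s ≤ N k})).Finite :=
    Set.finite_iUnion fun k => ((finite_wt_le _).image _).prod ((finite_wt_le _).image _)
  refine fin.subset ?_
  rintro ⟨⟨β, s⟩, β', s'⟩ h
  by_contra hcon
  refine h ?_
  rw [OmMode_eq_sum, LinearMap.sum_apply, map_sum, Finsupp.finsetSum_apply]
  refine Finset.sum_eq_zero fun k _ => ?_
  rw [boxField_apply]
  refine finsum_induction (fun w => ((basisVQ ℓ).tensorProduct (basisVQ ℓ)).repr w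
    (⟨γ, t⟩, ⟨γ', t'⟩) = 0) (by simp) (fun x y hx hy => by simp [hx, hy]) fun p => ?_
  rw [TensorProduct.map_tmul, Module.Basis.tensorProduct_repr_tmul_apply, smul_eq_mul]
  by_contra hne
  have h1 : ¬(latV k + β ≠ γ ∨ wt t ≠ wt s - (p + 1 + latForm (latV k) β)) := fun hh =>
    right_ne_zero_of_mul hne
    (coeff_eq_zero_of_mem_gr (expField_mem_gr (latV k) p (basisVQ_mem_gr ⟨β, s⟩)) hh)
  have h2 : ¬(-latV k + β' ≠ γ' ∨
      wt t' ≠ wt s' - (m - 1 - p + 1 + latForm (-latV k) β')) := fun hh => left_ne_zero_of_mul hne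
    (coeff_eq_zero_of_mem_gr (expField_mem_gr (-latV k) (m - 1 - p) (basisVQ_mem_gr ⟨β', s'⟩)) hh)
  simp only [not_or, not_not] at h1 h2
  obtain ⟨h1, h1'⟩ := h1
  obtain ⟨h2, h2'⟩ := h2
  obtain rfl : β = γ - latV k := by rw [← h1]; abel
  obtain rfl : β' = γ' + latV k := by rw [← h2]; abel
  have w1 := wt_nonneg s
  have w2 := wt_nonneg s'
  apply hcon
  refine Set.mem_iUnion.2 ⟨k, ⟨s, ?_, rfl⟩, ⟨s', ?_, rfl⟩⟩
  · simp only [hN, Set.mem_ofPred_eq]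
    omega
  · simp only [hN, Set.mem_ofPred_eq]
    omega

end LatticeVA

open LatticeVA in
open scoped TensorProduct in
theorem mainTheorem8 (ℓ : ℕ) (X : Module.End ℂ (LatticeVA.VQ ℓ))
    (hX : X ∈ LatticeVA.affineSpace ℓ) (Z : LatticeVA.VQ ℓ)
    (hZ : LatticeVA.IsExpApply X (LatticeVA.vac ℓ) Z) (m : ℤ) (hm : 0 ≤ m) :
    LatticeVA.OmMode ℓ m (Z ⊗ₜ[ℂ] Z) = 0 := by
  set B := basisVQ ℓ with hB
  refine (B.tensorProduct B).ext_elem fun a => ?_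
  rw [map_zero, Finsupp.zero_apply]
  set F := (OmMode_coeff_finite m a).toFinset with hF
  set c : (Σ _ : Lat ℓ, Fin ℓ × ℕ →₀ ℕ) × (Σ _ : Lat ℓ, Fin ℓ × ℕ →₀ ℕ) → ℂ := fun i =>
    (B.tensorProduct B).repr (OmMode ℓ m (B i.1 ⊗ₜ B i.2)) a with hc
  have expand : ∀ x y : VQ ℓ, (B.tensorProduct B).repr (OmMode ℓ m (x ⊗ₜ y)) a =
      ∑ i ∈ F, c i * (B.repr x i.1 * B.repr y i.2) := by
    have e : ((B.tensorProduct B).coord a).comp (OmMode ℓ m) =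
        ∑ i ∈ F, c i • (B.tensorProduct B).coord i := by
      refine (B.tensorProduct B).ext fun i => ?_
      simp only [LinearMap.sum_apply, LinearMap.smul_apply, Module.Basis.coord_apply,
        Module.Basis.repr_self, smul_eq_mul, LinearMap.comp_apply, Finsupp.single_apply, mul_ite,
        mul_one, mul_zero, Finset.sum_ite_eq]
      rw [Module.Basis.tensorProduct_apply']
      split_ifs with h
      · rfl
      · by_contra hne
        exact h ((Set.Finite.mem_toFinset _).2 hne)
    intro x y
    have := LinearMap.congr_fun e (x ⊗ₜ y)
    simp only [LinearMap.sum_apply, LinearMap.smul_apply, Module.Basis.coord_apply,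
      smul_eq_mul, LinearMap.comp_apply] at this
    rw [this]
    refine Finset.sum_congr rfl ?_
    rintro ⟨i, j⟩ -
    rw [Module.Basis.tensorProduct_repr_tmul_apply, smul_eq_mul, mul_comm (B.repr y j)]
  rw [expand]
  -- The hypothesis of `IsExpApply` concerns exactly the coordinates with respect to `B`.
  refine sum_mul_eq_zero_of_cauchy F c
    (fun i n => B.repr ((n.factorial : ℂ)⁻¹ • (X ^ n) (vac ℓ)) i) (fun i => B.repr Z i)
    (fun i => ?_) fun n => ?_
  · simp only [map_smul]
    exact hZ i.1 i.2
  · have := congrArg (fun w => (B.tensorProduct B).repr w a) (OmMode_cauchy hX hm n)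
    simp only [map_sum, map_zero, Finsupp.finsetSum_apply, expand, Finsupp.zero_apply] at this
    rw [Finset.sum_comm] at this
    simpa only [Finset.mul_sum] using this
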